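/- **Notation.** Let $r\ge 1$ and $k\in\mathbb N^r$, $|k|=\sum_i k_i$. Consider rational functions over $\mathbb C$ in the variables $t^{(i)}_s$ ($1\le i\le r$, $1\le s\le k_i$). Let $G_k=\prod_i\Sigma_{k_i}$ permute the variables with equal upper index, and let $\mathrm{Sym}_k\,x=\sum_{\pi\in G_k}\pi\cdot x$. For $J:\{1,\dots,|k|\}\to\{1,\dots,r\}$ with $\#J^{-1}(i)=k_i$ for all $i$, write $t_u=t^{(J(u))}_{c(u)}$ with $c(u)=\#\{v\le u: J(v)=J(u)\}$, and $t_0=0$; let $dV_k$ be the standard volume form. The canonical differential form of weight $k$ is $$\Omega_k=\sum_J \mathrm{Sym}_k\Big(\prod_{u=1}^{|k|}\frac1{t_u-t_{u-1}}\Big)dV_k\otimes \tilde f_{J(|k|)}\cdots\tilde f_{J(2)}\tilde f_{J(1)},$$ with values in the free associative algebra $U_r$ on $\tilde f_1,\dots,\tilde f_r$. Let $\mathfrak n$ be the Lie algebra generated by $f_1,\dots,f_r$ subject to the Serre relations of type $B_r$, whose simple roots are $\alpha_i=\epsilon_i-\epsilon_{i+1}$ ($i<r$) and $\alpha_r=\epsilon_r$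 (short). Let $\Omega^{\mathfrak g}_k$ be the image of $\Omega_k$ under the map $\tilde f_i\mapsto f_i$ from $U_r$ to $U(\mathfrak n)$. The positive roots are $\epsilon_i$ ($1\le i\le r$) and $\epsilon_i\pm\epsilon_j$ ($1\le i<j\le r$). Order them so that roots with larger $i$ come first and, for fixed $i$, $$\epsilon_i+\epsilon_{i+1}<\dots<\epsilon_i+\epsilon_r<\epsilon_i<\epsilon_i-\epsilon_r<\dots<\epsilon_i-\epsilon_{i+1}.$$ With $[f_{(a_1,\dots,a_n)}]=[f_{a_1},[f_{a_2},[\dots,[f_{a_{n-1}},f_{a_n}]\dots]]]$ put $$F_{\epsilon_i}=[f_{(i,i+1,\dots,r)}],\qquad F_{\epsilon_i-\epsilon_j}=[f_{(i,i+1,\dots,j-1)}],\qquad F_{\epsilon_i+\epsilon_j}=\big[[f_{(r,r-1,\dots,j)}],[f_{(i,i+1,\dots,r)}]\big].$$ For a positive root $\beta$ let $k_u$ be the coefficient of $\alpha_u$ in $\beta$. The atom $\eta_\beta$ is the coefficient of $dV_k\otimes F_\beta$ in the expansion $\Omega^{\mathfrak g}_k=\sum_p\omega_p\,dV_k\otimes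 F_{\beta_1}^{p_1}\cdots F_{\beta_m}^{p_m}$, where $\beta_1<\dots<\beta_m$ are the positive roots and $p\in\mathbb N^m$ runs over the exponents with $\sum_l p_l\beta_l=\beta$. **Theorem (type $B_r$).** For every positive root $\beta$ such an expansion exists, the coefficient $\eta_\beta$ does not depend on the expansion, and: 1. For $\beta=\epsilon_i-\epsilon_j$ with $1\le i<j\le r$, and for $\beta=\epsilon_i$ (put $j=r+1$), $$\eta_{\beta}=\frac{1}{t_1^{(j-1)}\,(t_1^{(j-2)}-t_1^{(j-1)})\cdots(t_1^{(i)}-t_1^{(i+1)})}.$$ 2. For $1\le i<j\le r$, $$\eta_{\epsilon_i+\epsilon_j}=\frac12\,\mathrm{Sym}_k\left(\frac{a_{r-1}-b_{r-1}}{\prod_{u=j}^{r-1}(a_u-a_{u-1})\;(t_1^{(r)}-a_{r-1})(t_2^{(r)}-a_{r-1})(b_{r-1}-t_1^{(r)})(b_{r-1}-t_2^{(r)})\;\prod_{u=i}^{r-2}(b_u-b_{u+1})}\right),$$ where $k=(0^{i-1}1^{j-i}2^{r-j+1})$, $a_u=t_1^{(u)}$ for $j\le u\le r-1$, $a_{j-1}=0$,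 and $b_u=t_2^{(u)}$ for $j\le u\le r-1$, $b_u=t_1^{(u)}$ (the only variable with this upper index) for $i\le u<j$. So for $j<r$ the numerator is $t_1^{(r-1)}-t_2^{(r-1)}$ and the first product is $t_1^{(j)}\prod_{u=j+1}^{r-1}(t_1^{(u)}-t_1^{(u-1)})$; for $j=r$ we have $a_{r-1}=0$ and the first product is empty. -/

import Mathlib

open scoped TensorProduct

noncomputable section

namespace TypeB

/-! Colours `1, …, r` are represented by `Fin r = {0, …, r - 1}`: the colour `u : Fin r`
stands for `u + 1`, and lower indices of variables are shifted in the same way. -/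

/-! ### Rational functions in the variables `t^{(u)}_s`, `u < r`, `s < k u` -/

/-- Rational functions over `ℂ` in the variables `t^{(u)}_s`, `u : Fin r`, `s : Fin (k u)`. -/
abbrev RatFun {r : ℕ} (k : Fin r → ℕ) : Type :=
  FractionRing (MvPolynomial (Σ u : Fin r, Fin (k u)) ℂ)

/-- The variable `t^{(u)}_s`. -/
def tv {r : ℕ} (k : Fin r → ℕ) (u : Fin r) (s : Fin (k u)) : RatFun k :=
  algebraMap (MvPolynomial (Σ u : Fin r, Fin (k u)) ℂ) (RatFun k) (MvPolynomial.X ⟨u, s⟩)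

/-- The variable `t^{(u)}_s` addressed by natural numbers (`0` if there is no such variable). -/
def tn {r : ℕ} (k : Fin r → ℕ) (u s : ℕ) : RatFun k :=
  if h : ∃ hu : u < r, s < k ⟨u, hu⟩ then tv k ⟨u, h.1⟩ ⟨s, h.2⟩ else 0

/-- An element `π` of `G_k = ∏_u Σ_{k_u}` acting on rational functions by
`t^{(u)}_s ↦ t^{(u)}_{π_u(s)}`. -/
def permute {r : ℕ} {k : Fin r → ℕ} (π : ∀ u : Fin r, Equiv.Perm (Fin (k u))) :
    RatFun k ≃+* RatFun k :=
  IsFractionRing.ringEquivOfRingEquiv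
    (MvPolynomial.renameEquiv ℂ (Equiv.sigmaCongrRight π)).toRingEquiv

/-- The symmetrizer `Sym_k x = ∑_{π ∈ G_k} π • x`. -/
def sym {r : ℕ} (k : Fin r → ℕ) (x : RatFun k) : RatFun k :=
  ∑ π : (∀ u : Fin r, Equiv.Perm (Fin (k u))), permute π x

/-! ### The canonical differential form of weight `k` -/

/-- Multi-indices `J : {1, …, |k|} → {1, …, r}` with `#J⁻¹(u) = k_u` for all `u`. -/
abbrev MultiIndex {r : ℕ} (k : Fin r → ℕ) : Type :=
  {J : Fin (∑ u, k u) → Fin r //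
    ∀ u : Fin r, (Finset.univ.filter fun v => J v = u).card = k u}

/-- `c(v)`: the position of `v` within the fibre of `J` that contains it. -/
def MultiIndex.c {r : ℕ} {k : Fin r → ℕ} (J : MultiIndex k) (v : Fin (∑ u, k u)) :
    Fin (k (J.1 v)) :=
  ⟨(Finset.univ.filter fun w => w < v ∧ J.1 w = J.1 v).card, by
    rw [← J.2 (J.1 v)]
    apply Finset.card_lt_card
    refine ⟨fun w hw => ?_, fun h => ?_⟩
    · simp only [Finset.mem_filter, Finset.mem_univ, true_and] at hw ⊢
      exact hw.2
    · have hv : v ∈ Finset.univ.filter fun w => J.1 w = J.1 v := by simp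
      have := h hv
      simp at this⟩

/-- The variable `t_v`, identified with `t^{(J(v))}_{c(v)}`. -/
def MultiIndex.t {r : ℕ} {k : Fin r → ℕ} (J : MultiIndex k) (v : Fin (∑ u, k u)) : RatFun k :=
  tv k (J.1 v) (J.c v)

/-- The variable preceding `t_v`; it is `0` for the first `v`. -/
def MultiIndex.tPrev {r : ℕ} {k : Fin r → ℕ} (J : MultiIndex k) (v : Fin (∑ u, k u)) :
    RatFun k :=
  if 0 < v.val then J.t ⟨v.val - 1, lt_of_le_of_lt (Nat.sub_le _ _) v.isLt⟩ else 0

/-- The rational function `∏_{v = 1}^{|k|} 1 / (t_v - t_{v - 1})`, with `t_0 = 0`. -/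
def MultiIndex.chain {r : ℕ} {k : Fin r → ℕ} (J : MultiIndex k) : RatFun k :=
  ∏ v : Fin (∑ u, k u), (J.t v - J.tPrev v)⁻¹

/-- The monomial `f̃_J = f̃_{J(|k|)} ⋯ f̃_{J(2)} f̃_{J(1)}` in the free associative algebra. -/
def MultiIndex.monomial {r : ℕ} {k : Fin r → ℕ} (J : MultiIndex k) : FreeAlgebra ℂ (Fin r) :=
  (List.ofFn fun v => FreeAlgebra.ι ℂ (J.1 v)).reverse.prod

/-- The canonical differential form
`Ω_k = ∑_J Sym_k (∏_v 1 / (t_v - t_{v - 1})) dV_k ⊗ f̃_J`.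
A differential form of top degree is represented by its coefficient with respect to the
standard volume form `dV_k`. -/
def canonicalForm {r : ℕ} (k : Fin r → ℕ) : RatFun k ⊗[ℂ] FreeAlgebra ℂ (Fin r) :=
  ∑ J : MultiIndex k, sym k J.chain ⊗ₜ[ℂ] J.monomial

/-! ### The algebra `U(𝔫)` for type `B_r` -/

/-- The Cartan integers `2 (α_i, α_j) / (α_i, α_i)` of type `B_r`,
the last simple root being the short one. -/
def cartan {r : ℕ} (i j : Fin r) : ℤ :=
  if i = j then 2
  else if i.val + 1 = j.val ∨ j.val + 1 = i.val then (if i.val + 1 = r then -2 else -1)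
  else 0

/-- The ideal of the free Lie algebra on `f_1, …, f_r` generated by the Serre relations
`(ad f_i) ^ (1 - cartan i j) (f_j) = 0`, `i ≠ j`. -/
def serreIdeal (r : ℕ) : LieIdeal ℂ (FreeLieAlgebra ℂ (Fin r)) :=
  LieSubmodule.lieSpan ℂ _
    {x | ∃ i j : Fin r, i ≠ j ∧
      x = ((LieAlgebra.ad ℂ (FreeLieAlgebra ℂ (Fin r)) (FreeLieAlgebra.of ℂ i)) ^
        (1 - cartan i j).toNat) (FreeLieAlgebra.of ℂ j)}

/-- The nilpotent Lie algebra `𝔫` of type `B_r`. -/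
abbrev Nil (r : ℕ) : Type := FreeLieAlgebra ℂ (Fin r) ⧸ serreIdeal r

/-- The Chevalley generators `f_i` of `𝔫`. -/
def f {r : ℕ} (i : Fin r) : Nil r := LieSubmodule.Quotient.mk (FreeLieAlgebra.of ℂ i)

/-- The universal enveloping algebra `U(𝔫)`. -/
abbrev UNil (r : ℕ) : Type := UniversalEnvelopingAlgebra ℂ (Nil r)

/-- The quotient map `q : U_r → U(𝔫)`, `f̃_i ↦ f_i`. -/
def q (r : ℕ) : FreeAlgebra ℂ (Fin r) →ₐ[ℂ] UNil r :=
  FreeAlgebra.lift ℂ fun i => UniversalEnvelopingAlgebra.ι ℂ (f i)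

/-- The canonical differential form `Ω^𝔤_k = (id ⊗ q) Ω_k` for `𝔤` of type `B_r`. -/
def canonicalFormB {r : ℕ} (k : Fin r → ℕ) : RatFun k ⊗[ℂ] UNil r :=
  LinearMap.lTensor (RatFun k) (q r).toLinearMap (canonicalForm k)

/-! ### Positive roots, root vectors and the PBW monomials -/

/-- The positive roots of `B_r`. -/
inductive Root (r : ℕ) : Type
  /-- `ε_i` -/
  | short (i : Fin r) : Root r
  /-- `ε_i - ε_j`, `i < j` -/
  | minus (i j : Fin r) (h : i < j) : Root r
  /-- `ε_i + ε_j`, `i < j` -/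
  | plus (i j : Fin r) (h : i < j) : Root r

/-- The coefficients of a positive root with respect to the simple roots. -/
def Root.content {r : ℕ} : Root r → Fin r → ℕ
  | .short i => fun u => if i ≤ u then 1 else 0
  | .minus i j _ => fun u => if i ≤ u ∧ u < j then 1 else 0
  | .plus i j _ => fun u => if u < i then 0 else if u < j then 1 else 2

/-- All positive roots, in increasing order: those with larger first index `i` come first, and
for a fixed `i` the order is
`ε_i + ε_{i+1} < ⋯ < ε_i + ε_r < ε_i < ε_i - ε_r < ⋯ < ε_i - ε_{i+1}`. -/
def rootList (r : ℕ) : List (Root r) :=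
  (List.finRange r).reverse.flatMap fun i =>
    (List.finRange r).filterMap (fun j => if h : i < j then some (Root.plus i j h) else none)
    ++ [Root.short i]
    ++ (List.finRange r).reverse.filterMap
        (fun j => if h : i < j then some (Root.minus i j h) else none)

/-- The iterated bracket `[f_{J(1)}, [f_{J(2)}, […, [f_{J(n-1)}, f_{J(n)}]…]]]`. -/
def bracket {r : ℕ} : List (Fin r) → Nil r
  | [] => 0
  | [a] => f a
  | a :: b :: l => ⁅f a, bracket (b :: l)⁆

/-- The colours `u` with `a ≤ u < b`, in increasing order. -/
def interval (r a b : ℕ) : List (Fin r) :=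
  (List.finRange r).filter fun u => a ≤ u.val ∧ u.val < b

/-- The root vectors: `F_{ε_i} = [f_{(i, …, r)}]`, `F_{ε_i - ε_j} = [f_{(i, …, j-1)}]` and
`F_{ε_i + ε_j} = [[f_{(r, r-1, …, j)}], [f_{(i, i+1, …, r)}]]`. -/
def Root.F {r : ℕ} : Root r → Nil r
  | .short i => bracket (interval r i r)
  | .minus i j _ => bracket (interval r i j)
  | .plus i j _ => ⁅bracket (interval r j r).reverse, bracket (interval r i r)⁆

/-- The PBW monomial `F_{β_1}^{p_1} ⋯ F_{β_m}^{p_m}`, where `β_1 < ⋯ < β_m` are the positive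
roots. -/
def pbw {r : ℕ} (p : Root r →₀ ℕ) : UNil r :=
  ((rootList r).map fun β => UniversalEnvelopingAlgebra.ι ℂ β.F ^ p β).prod

/-- The content of the PBW monomial with exponents `p`. -/
def pbwContent {r : ℕ} (p : Root r →₀ ℕ) : Fin r → ℕ :=
  fun u => p.sum fun β m => m * β.content u

/-- `ω` is the family of coefficients of an expansion
`Ω^𝔤_k = ∑_p ω_p dV_k ⊗ F_{β_1}^{p_1} ⋯ F_{β_m}^{p_m}`,
the sum being over exponents `p` of content `k`. -/
def IsPBWExpansion {r : ℕ} (k : Fin r → ℕ) (ω : (Root r →₀ ℕ) →₀ RatFun k) : Prop :=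
  (∀ p ∈ ω.support, pbwContent p = k) ∧
    canonicalFormB k = ω.sum fun p a => a ⊗ₜ[ℂ] pbw p

/-- `η` is the atom `η_β`: with `k` the content of `F_β`, the form `Ω^𝔤_k` has a PBW expansion,
and in every such expansion `η` is the coefficient of `F_β`. -/
def IsAtom {r : ℕ} (β : Root r) (η : RatFun β.content) : Prop :=
  (∃ ω, IsPBWExpansion β.content ω) ∧
    ∀ ω, IsPBWExpansion β.content ω → ω (Finsupp.single β 1) = η

/-! ### The explicit rational functions -/

/-- The string `1 / (t_1^{(b)} (t_1^{(b-1)} - t_1^{(b)}) ⋯ (t_1^{(a)} - t_1^{(a+1)}))`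
over the colours from `a` to `b`. -/
def string {r : ℕ} (k : Fin r → ℕ) (a b : ℕ) : RatFun k :=
  1 / (tn k b 0 * ∏ u ∈ Finset.Ico a b, (tn k u 0 - tn k (u + 1) 0))

/-- The labels of the first branch of the double-edge diagram: `t_1^{(u)}` for `u ≥ j`;
the vertex preceding the colour `j` is the root, labelled `0`. -/
def labelA {r : ℕ} (k : Fin r → ℕ) (j u : ℕ) : RatFun k := if j ≤ u then tn k u 0 else 0

/-- The labels of the second branch of the double-edge diagram: `t_2^{(u)}` for the colours
`u ≥ j`, which occur twice, and the only variable `t_1^{(u)}` for `u < j`. -/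
def labelB {r : ℕ} (k : Fin r → ℕ) (j u : ℕ) : RatFun k := if j ≤ u then tn k u 1 else tn k u 0

/-- The rational function of the double-edge diagram. In 1-based notation, with `a_u` and `b_u`
the labels of the two branches,
`(a_{r-1} - b_{r-1}) / (∏_{u=j}^{r-1} (a_u - a_{u-1})
  · (t_1^{(r)} - a_{r-1}) (t_2^{(r)} - a_{r-1}) (b_{r-1} - t_1^{(r)}) (b_{r-1} - t_2^{(r)})
  · ∏_{u=i}^{r-2} (b_u - b_{u+1}))`. -/
def doubleEdge {r : ℕ} (k : Fin r → ℕ) (i j : ℕ) : RatFun k :=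
  (labelA k j (r - 2) - labelB k j (r - 2)) /
    ((∏ u ∈ Finset.Ico j (r - 1), (labelA k j u - labelA k j (u - 1))) *
      ((tn k (r - 1) 0 - labelA k j (r - 2)) * (tn k (r - 1) 1 - labelA k j (r - 2)) *
        (labelB k j (r - 2) - tn k (r - 1) 0) * (labelB k j (r - 2) - tn k (r - 1) 1)) *
      ∏ u ∈ Finset.Ico i (r - 2), (labelB k j u - labelB k j (u + 1)))

end TypeB

end

/-!
Write `Ω^𝔤_k = ∑_J Sym_k (chain J) ⊗ f_{J(n)} ⋯ f_{J(1)}`. The atom of a positive root `β` is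
computed with one linear form `φ` on `U(𝔫)` which is `±1` on `F_β` and vanishes on all the other
PBW monomials of the same content: then `η_β = ± ∑_J φ(f_{J(n)} ⋯ f_{J(1)}) Sym_k (chain J)`,
whatever the expansion.

The form `φ = coeff β` is a matrix coefficient of the vector representation of `𝔰𝔬(2r + 1)`. There,
the generators act along a path `0 → 1 → ⋯ → 2r` with edges of colours `0, …, r - 1, r - 1, …, 0`
(`step`, `label`), all nonzero entries being `1`; the Serre relations hold because each word
occurring in them vanishes (`step_serre`). If `i` is the first index of `β`, the matrix coefficient
goes from a vertex `β.start` to the vertex `2r - i`. The content of `β` is `1` in the place `i` and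
`0` before, so a PBW monomial of this content has exactly one factor with first index `i`, and none
with a smaller one. This factor is the last one, so it acts first; for reasons of weight it kills
the vertex `β.start` unless it is `F_β` (`nilRep_F_start_eq_zero`, `coeff_pbw_eq_zero`). On the
other hand, exactly one word has a nonzero coefficient: the one that spells the colours along
the path (`pathRep_word`). Hence `η_β = ± Sym_k (chain J)` for a single multi-index `J`
(`isAtom_pathIndex`). For `ε_i - ε_j` and `ε_i` this chain is the string. For `ε_i + ε_j` it runs
through both variables of the last colour in a row, and a partial fraction identity
(`chain_add_swap`) turns its symmetrization in these two variables into the double edge.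

Existence of an expansion is the spanning half of the PBW theorem, with contents recorded
(`prod_mem_pbwSpan`). It follows by straightening from the fact that the root vectors span `𝔫`
compatibly with weights: the bracket of a generator with a root vector lies in the span of the root
vectors of the right weight (`gen_lie_F_mem`). The latter is computed from the Serre relations, in
an arbitrary Lie algebra containing elements which satisfy them (`SerreB`).
-/

noncomputable section

namespace TypeB

attribute [local instance] LieRing.ofAssociativeRing

/-! ### Serre relations and strings of generators in a Lie algebra -/

/-- The Serre relations of type `B_{s+1}` for a sequence of elements `x_0, x_1, …` of a Lie algebra,
`x_s` belonging to the short simple root. A finite family is extended by zero to all of `ℕ`. -/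
structure SerreB {L : Type*} [LieRing L] (s : ℕ) (x : ℕ → L) : Prop where
  comm : ∀ a b, a + 2 ≤ b → ⁅x a, x b⁆ = 0
  up : ∀ a, ⁅x a, ⁅x a, x (a + 1)⁆⁆ = 0
  down : ∀ a, a + 1 ≠ s → ⁅x (a + 1), ⁅x (a + 1), x a⁆⁆ = 0
  three : ∀ a, a + 1 = s → ⁅x s, ⁅x s, ⁅x s, x a⁆⁆⁆ = 0

/-- The iterated bracket `[x_a, [x_{a+1}, […, x_{a+n}]…]]`. -/
def str {L : Type*} [LieRing L] (x : ℕ → L) : ℕ → ℕ → L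
  | a, 0 => x a
  | a, n + 1 => ⁅x a, str x (a + 1) n⁆

section Lie

variable {L : Type*} [LieRing L] [LieAlgebra ℂ L]

omit [LieAlgebra ℂ L] in
lemma lie_str_eq_zero (x : ℕ → L) (y : L) (a n : ℕ)
    (h : ∀ u, a ≤ u → u ≤ a + n → ⁅y, x u⁆ = 0) : ⁅y, str x a n⁆ = 0 := by
  induction n generalizing a with
  | zero => exact h a le_rfl le_rfl
  | succ n ih =>
    rw [str, leibniz_lie, h a le_rfl (by omega),
      ih (a + 1) (fun u h1 h2 => h u (by omega) (by omega))]
    simp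

/-- In rank two, the vector representation of `B_2` has length five: if `Z` is killed by `X` and
`Y ^ 2`, then `X Y X X Y Z = 0`. The relation `[Y, [Y, X]] = 0` applied to `Z` gives `Y X Y Z = 0`,
and then the quartic Serre relation applied to `Y Z` gives the claim. -/
lemma lie_five_eq_zero {X Y Z : L} (h1 : ⁅X, Z⁆ = 0) (h2 : ⁅Y, ⁅Y, Z⁆⁆ = 0)
    (h3 : ⁅X, ⁅X, ⁅X, ⁅Y, Z⁆⁆⁆⁆ = 0) (h4 : ⁅Y, ⁅Y, X⁆⁆ = 0) (h5 : ⁅X, ⁅X, ⁅X, Y⁆⁆⁆ = 0) :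
    ⁅X, ⁅Y, ⁅X, ⁅X, ⁅Y, Z⁆⁆⁆⁆⁆ = 0 := by
  have e1 : ⁅⁅Y, ⁅Y, X⁆⁆, Z⁆ = 0 := by rw [h4, zero_lie]
  have e2 : ⁅⁅X, ⁅X, ⁅X, Y⁆⁆⁆, ⁅Y, Z⁆⁆ = 0 := by rw [h5, zero_lie]
  simp only [lie_lie, h1, h2, lie_zero, sub_zero, zero_sub, lie_neg] at e1
  -- `e1` now says that `Y X Y Z = 0`
  have e1' : ⁅Y, ⁅X, ⁅Y, Z⁆⁆⁆ = 0 := by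
    have : (2 : ℂ) • ⁅Y, ⁅X, ⁅Y, Z⁆⁆⁆ = 0 := by linear_combination (norm := module) (-1 : ℂ) • e1
    simpa using this
  simp only [lie_lie, h2, h3, e1', lie_zero, sub_zero, zero_sub, lie_neg] at e2
  have : (3 : ℂ) • ⁅X, ⁅Y, ⁅X, ⁅X, ⁅Y, Z⁆⁆⁆⁆⁆ = 0 := by
    linear_combination (norm := module) (1 : ℂ) • e2
  simpa using this

namespace SerreB

set_option linter.unusedSectionVars false

variable {s : ℕ} {x : ℕ → L} (h : SerreB s x)
include h

lemma comm' {a b : ℕ} (hab : a + 2 ≤ b ∨ b + 2 ≤ a) : ⁅x a, x b⁆ = 0 := by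
  rcases hab with hab | hab
  · exact h.comm a b hab
  · rw [← lie_skew, h.comm b a hab, neg_zero]

lemma lie_str_of_far {i a n : ℕ} (hi : i + 2 ≤ a ∨ a + n + 2 ≤ i) : ⁅x i, str x a n⁆ = 0 :=
  lie_str_eq_zero x _ a n fun u h1 h2 => h.comm' (by omega)

/-- Strings over consecutive intervals of colours concatenate. -/
lemma str_append (a n m : ℕ) : ⁅str x a n, str x (a + n + 1) m⁆ = str x a (n + m + 1) := by
  induction n generalizing a with
  | zero => simp [str]
  | succ n ih =>
    rw [str, lie_lie, h.lie_str_of_far (by omega), lie_zero, sub_zero]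
    have := ih (a + 1)
    rw [show a + 1 + n + 1 = a + (n + 1) + 1 by ring] at this
    rw [this, show n + 1 + m + 1 = n + m + 1 + 1 by ring, ← str]

lemma str_succ (a n : ℕ) : ⁅str x a n, x (a + n + 1)⁆ = str x a (n + 1) := h.str_append a n 0

/-- A generator commutes with a longer string starting with it. -/
lemma lie_first (a n : ℕ) : ⁅x a, str x a (n + 1)⁆ = 0 := by
  cases n with
  | zero => exact h.up a
  | succ n =>
    have e := h.str_append a 1 n
    rw [show 1 + n + 1 = n + 1 + 1 by ring] at e
    have c : ⁅x a, str x (a + 1 + 1) n⁆ = 0 := h.lie_str_of_far (by omega)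
    have u : ⁅x a, str x a 1⁆ = 0 := h.up a
    rw [← e, leibniz_lie, c, u, zero_lie, lie_zero, add_zero]

/-- A generator of a long simple root commutes with a longer string ending with it. -/
lemma lie_last {a n : ℕ} (hs : a + n + 1 ≠ s) : ⁅x (a + n + 1), str x a (n + 1)⁆ = 0 := by
  cases n with
  | zero =>
    have := h.down a hs
    rw [← lie_skew (x (a + 1)) (x a), lie_neg, neg_eq_zero] at this
    simpa [str] using this
  | succ n =>
    have e := h.str_append a n 1
    have d := h.down (a + n + 1) hs
    rw [← lie_skew (x (a + n + 1 + 1)) (x (a + n + 1)), lie_neg, neg_eq_zero] at d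
    rw [← e, leibniz_lie, h.lie_str_of_far (by omega)]
    simp only [str, zero_lie, zero_add]
    rw [show a + (n + 1) + 1 = a + n + 1 + 1 by ring, d, lie_zero]

lemma lie_second {a : ℕ} (n : ℕ) (hs : a + 1 ≠ s) : ⁅x (a + 1), str x a (n + 2)⁆ = 0 := by
  -- `Y = [x_{a+1}, Z]` commutes with `x_{a+1}`, and `Z` commutes with `x_a`
  set y := x (a + 1)
  set Z := str x (a + 2) n
  have e1 : ⁅y, ⁅y, Z⁆⁆ = 0 := h.lie_first (a + 1) n
  have e2 : ⁅x a, Z⁆ = 0 := h.lie_str_of_far (by omega)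
  have e3 : ⁅y, ⁅y, x a⁆⁆ = 0 := h.down a hs
  have e4 : ⁅⁅y, ⁅y, x a⁆⁆, Z⁆ = 0 := by rw [e3, zero_lie]
  simp only [lie_lie, e1, e2, lie_zero, sub_zero, zero_sub, lie_neg] at e4
  have : (2 : ℂ) • ⁅y, ⁅x a, ⁅y, Z⁆⁆⁆ = 0 := by linear_combination (norm := module) (-1 : ℂ) • e4
  change ⁅y, ⁅x a, ⁅y, Z⁆⁆⁆ = 0
  simpa using this

/-- A generator commutes with the strings in which its colour is neither the first nor the last. -/
lemma lie_interior {a k : ℕ} (n : ℕ) (hs : a + k + 1 ≠ s) :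
    ⁅x (a + k + 1), str x a (k + n + 2)⁆ = 0 := by
  cases k with
  | zero => simpa using h.lie_second n hs
  | succ k =>
    have e := h.str_append a k (n + 2)
    rw [show k + 1 + n + 2 = k + (n + 2) + 1 by ring, ← e, leibniz_lie,
      h.lie_str_of_far (by omega), zero_lie, zero_add,
      show a + (k + 1) + 1 = a + k + 1 + 1 by ring, h.lie_second n (by omega), lie_zero]

omit h in
lemma str_self_lie (a : ℕ) (ha : a < s) : ⁅x a, str x (a + 1) (s - (a + 1))⁆ = str x a (s - a) := by
  rw [show s - a = s - (a + 1) + 1 by omega, str]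

/-- A generator `x_i` of a long simple root maps the short root vector `x_{a, …, s}` to the next
one, and to zero unless `i + 1 = a`. -/
lemma lie_short {i a : ℕ} (hi : i < s) (ha : a ≤ s) :
    ⁅x i, str x a (s - a)⁆ = if i + 1 = a then str x i (s - i) else 0 := by
  split_ifs with hia
  · subst hia; exact str_self_lie i hi
  · rcases lt_trichotomy i a with hlt | rfl | hgt
    · exact h.lie_str_of_far (by omega)
    · obtain ⟨n, rfl⟩ : ∃ n, s = i + n + 1 := ⟨s - i - 1, by omega⟩
      rw [show i + n + 1 - i = n + 1 by omega]
      exact h.lie_first i n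
    · obtain ⟨k, rfl⟩ : ∃ k, i = a + k + 1 := ⟨i - a - 1, by omega⟩
      obtain ⟨n, rfl⟩ : ∃ n, s = a + k + n + 2 := ⟨s - a - k - 2, by omega⟩
      rw [show a + k + n + 2 - a = k + n + 2 by omega]
      exact h.lie_interior n (by omega)

/-- The root vector of `ε_a + ε_s`, which is `[x_s, x_{a, …, s}]`, commutes with `x_s`. -/
lemma lie_lie_short {a : ℕ} (ha : a < s) : ⁅x s, ⁅x s, str x a (s - a)⁆⁆ = 0 := by
  obtain ⟨n, rfl⟩ : ∃ n, s = a + n + 1 := ⟨s - a - 1, by omega⟩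
  have e : ⁅str x a n, x (a + n + 1)⁆ = str x a (a + n + 1 - a) := by
    rw [h.str_succ]; congr 1; omega
  rw [← e]
  cases n with
  | zero =>
    have := h.three a rfl
    rw [← lie_skew (x (a + 0 + 1)) (x a), lie_neg, lie_neg, neg_eq_zero] at this
    simpa [str] using this
  | succ n =>
    have c : ⁅str x a n, x (a + (n + 1) + 1)⁆ = 0 := by
      rw [← lie_skew, h.lie_str_of_far (by omega), neg_zero]
    have c' : ⁅x (a + (n + 1) + 1), str x a n⁆ = 0 := h.lie_str_of_far (by omega)
    have t := h.three (a + (n + 1)) rfl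
    have move : ∀ W, ⁅x (a + (n + 1) + 1), ⁅str x a n, W⁆⁆ =
        ⁅str x a n, ⁅x (a + (n + 1) + 1), W⁆⁆ := fun W : L => by
      rw [leibniz_lie, c', zero_lie, zero_add]
    rw [← h.str_succ a n, lie_lie, c, lie_zero, sub_zero, move, move,
      ← lie_skew (x (a + n + 1)) (x (a + (n + 1) + 1)), lie_neg, lie_neg]
    rw [show a + n + 1 = a + (n + 1) by ring, t]
    simp

/-- The generator of the short simple root commutes with the root vectors of `ε_a + ε_b`. -/
lemma lie_plus {a b : ℕ} (hab : a < b) (hb : b ≤ s) :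
    ⁅x s, ⁅str x b (s - b), str x a (s - a)⁆⁆ = 0 := by
  obtain ⟨d, hd⟩ : ∃ d, s = b + d := ⟨s - b, by omega⟩
  -- `ε_a + ε_b` is reached from `ε_a + ε_{b+1}` by adding the simple root `α_b`
  have step : ∀ b, a < b → b < s → ⁅str x b (s - b), str x a (s - a)⁆ =
      ⁅x b, ⁅str x (b + 1) (s - (b + 1)), str x a (s - a)⁆⁆ := by
    intro b h1 h2
    rw [leibniz_lie, h.lie_short h2 (by omega), h.lie_short h2 (by omega)]
    rw [if_pos rfl, if_neg (by omega), lie_zero, add_zero]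
  induction d using Nat.strong_induction_on generalizing b with
  | _ d ih =>
  match d with
  | 0 =>
    obtain rfl : s = b := by omega
    rw [Nat.sub_self]
    exact h.lie_lie_short hab
  | 1 =>
    -- here `x_b` and `x_s` do not commute: use the `B_2`-string through `x_{a, …, b-1}`
    rw [step b hab (by omega)]
    obtain rfl : s = b + 1 := hd
    obtain ⟨n, rfl⟩ : ∃ n, b = a + n + 1 := ⟨b - a - 1, by omega⟩
    have e : str x a (a + n + 1 + 1 - a) = ⁅x (a + n + 1 + 1), ⁅x (a + n + 1), str x a n⁆⁆ := by
      rw [show a + n + 1 + 1 - a = n + 1 + 1 by omega, ← h.str_succ, ← h.str_succ, ← lie_skew,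
        ← lie_skew (str x a n), lie_neg, neg_neg]
      rfl
    have hq := h.lie_lie_short (show a < a + n + 1 + 1 by omega)
    rw [e] at hq ⊢
    have hx : str x (a + n + 1 + 1) (a + n + 1 + 1 - (a + n + 1 + 1)) = x (a + n + 1 + 1) := by
      rw [Nat.sub_self, str]
    rw [hx]
    have t := h.three (a + n + 1) rfl
    refine lie_five_eq_zero (h.lie_str_of_far (by omega)) ?_ hq (h.up _) t
    rw [← lie_skew (x (a + n + 1)) (str x a n), h.str_succ, lie_neg, h.lie_last (by omega),
      neg_zero]
  | d + 2 =>
    have := ih (d + 1) (by omega) (by omega : a < b + 1) (by omega) (by omega)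
    rw [step b hab (by omega), leibniz_lie, this, h.comm' (by omega), zero_lie, lie_zero, add_zero]

end SerreB
end Lie

/-! ### Root vectors span `𝔫` -/

/-- The Chevalley generators, indexed by natural numbers and extended by zero. -/
def gen (r u : ℕ) : Nil r := if h : u < r then f ⟨u, h⟩ else 0

lemma gen_val {r : ℕ} (i : Fin r) : gen r i = f i := by simp [gen]

lemma gen_of_le {r u : ℕ} (h : r ≤ u) : gen r u = 0 := by simp [gen, not_lt.2 h]

lemma mk_ad_pow {r : ℕ} (i : Fin r) (n : ℕ) (y : FreeLieAlgebra ℂ (Fin r)) :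
    (LieSubmodule.Quotient.mk (((LieAlgebra.ad ℂ (FreeLieAlgebra ℂ (Fin r))
      (FreeLieAlgebra.of ℂ i)) ^ n) y) : Nil r) =
      ((LieAlgebra.ad ℂ (Nil r) (f i)) ^ n) (LieSubmodule.Quotient.mk y) := by
  induction n with
  | zero => rfl
  | succ n ih =>
    rw [pow_succ', pow_succ', Module.End.mul_apply, Module.End.mul_apply, ← ih]
    rfl

lemma serre {r : ℕ} {i j : Fin r} (h : i ≠ j) :
    ((LieAlgebra.ad ℂ (Nil r) (f i)) ^ (1 - cartan i j).toNat) (f j) = 0 := by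
  rw [f, f, ← f, ← mk_ad_pow, LieSubmodule.Quotient.mk_eq_zero']
  exact LieSubmodule.subset_lieSpan ⟨i, j, h, rfl⟩

lemma serreB_gen (s : ℕ) : SerreB s (gen (s + 1)) where
  comm a b hab := by
    by_cases hb : b < s + 1
    · have := serre (r := s + 1) (i := ⟨a, by omega⟩) (j := ⟨b, hb⟩) (by simp; omega)
      rw [cartan, if_neg (by simp; omega), if_neg (by simp; omega)] at this
      simpa [gen, hb, show a < s + 1 by omega] using this
    · rw [gen_of_le (u := b) (by omega), lie_zero]
  up a := by
    by_cases hb : a + 1 < s + 1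
    · have := serre (r := s + 1) (i := ⟨a, by omega⟩) (j := ⟨a + 1, hb⟩) (by simp)
      rw [cartan, if_neg (by simp), if_pos (by simp), if_neg (by simp; omega)] at this
      simpa [gen, hb, show a < s + 1 by omega, pow_succ] using this
    · rw [gen_of_le (u := a + 1) (by omega), lie_zero, lie_zero]
  down a ha := by
    by_cases hb : a + 1 < s + 1
    · have := serre (r := s + 1) (i := ⟨a + 1, hb⟩) (j := ⟨a, by omega⟩) (by simp)
      rw [cartan, if_neg (by simp), if_pos (by simp), if_neg (by simp; omega)] at this
      simpa [gen, hb, show a < s + 1 by omega, pow_succ] using this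
    · rw [gen_of_le (u := a + 1) (by omega), zero_lie]
  three a ha := by
    subst ha
    have := serre (r := a + 1 + 1) (i := ⟨a + 1, by omega⟩) (j := ⟨a, by omega⟩) (by simp)
    rw [cartan, if_neg (by simp), if_pos (by simp), if_pos (by simp)] at this
    simpa [gen, pow_succ] using this

lemma mem_interval {r a b : ℕ} {u : Fin r} : u ∈ interval r a b ↔ a ≤ u.val ∧ u.val < b := by
  simp [interval]

lemma interval_pairwise (r a b : ℕ) : (interval r a b).Pairwise (· < ·) :=
  (List.pairwise_lt_finRange r).filter _

lemma interval_eq_nil {r a b : ℕ} (h : b ≤ a) : interval r a b = [] := by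
  rw [List.eq_nil_iff_forall_not_mem]
  intro u hu
  rw [mem_interval] at hu
  omega

lemma interval_eq_cons {r a b : ℕ} (hab : a < b) (hb : b ≤ r) :
    interval r a b = ⟨a, by omega⟩ :: interval r (a + 1) b := by
  refine (interval_pairwise r a b).eq_of_mem_iff
    (List.pairwise_cons.2 ⟨fun u hu => ?_, interval_pairwise _ _ _⟩) fun u => ?_
  · rw [mem_interval] at hu
    rw [Fin.lt_def]
    exact hu.1
  · simp only [mem_interval, List.mem_cons, Fin.ext_iff]
    omega

lemma interval_eq_concat {r a b : ℕ} (hab : a ≤ b) (hb : b < r) :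
    interval r a (b + 1) = interval r a b ++ [⟨b, hb⟩] := by
  refine (interval_pairwise r a _).eq_of_mem_iff
    (List.pairwise_append.2 ⟨interval_pairwise _ _ _, List.pairwise_singleton _ _, ?_⟩) fun u => ?_
  · intro u hu v hv
    rw [mem_interval] at hu
    rw [List.mem_singleton.1 hv, Fin.lt_def]
    exact hu.2
  · simp only [mem_interval, List.mem_append, List.mem_singleton, Fin.ext_iff]
    omega

lemma count_interval {r : ℕ} (a b : ℕ) (u : Fin r) :
    (interval r a b).count u = if a ≤ u.val ∧ u.val < b then 1 else 0 := by
  rw [interval]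
  split_ifs with h
  · rw [List.count_filter (by simpa using h)]
    exact List.count_eq_one_of_mem (List.nodup_finRange r) (List.mem_finRange u)
  · rw [List.count_eq_zero]
    simp only [List.mem_filter]
    simpa using h

lemma bracket_cons {r : ℕ} (a : Fin r) {l : List (Fin r)} (hl : l ≠ []) :
    bracket (a :: l) = ⁅f a, bracket l⁆ := by
  cases l with
  | nil => exact absurd rfl hl
  | cons b l => rfl

lemma bracket_interval {r a n : ℕ} (h : a + n < r) :
    bracket (interval r a (a + n + 1)) = str (gen r) a n := by
  induction n generalizing a with
  | zero =>
    rw [interval_eq_cons (by omega) (by omega), interval_eq_nil (by omega)]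
    exact (gen_val _).symm
  | succ n ih =>
    have ha := ih (a := a + 1) (by omega)
    rw [show a + 1 + n + 1 = a + (n + 1) + 1 by ring] at ha
    rw [interval_eq_cons (by omega) (by omega), bracket_cons, ha, str, ← gen_val]
    rw [interval_eq_cons (by omega) (by omega)]
    simp

/-- Reversing the colours of a string changes the iterated bracket by a sign. -/
lemma bracket_interval_reverse {s a n : ℕ} (h : a + n < s + 1) :
    bracket (interval (s + 1) a (a + n + 1)).reverse = (-1 : ℂ) ^ n • str (gen (s + 1)) a n := by
  induction n with
  | zero =>
    rw [interval_eq_cons (by omega) (by omega), interval_eq_nil (by omega), pow_zero, one_smul]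
    exact (gen_val _).symm
  | succ n ih =>
    rw [interval_eq_concat (by omega) (by omega), List.reverse_append, List.reverse_singleton,
      List.singleton_append, bracket_cons]
    · have e : bracket (interval (s + 1) a (a + (n + 1))).reverse =
          (-1 : ℂ) ^ n • str (gen (s + 1)) a n := ih (by omega)
      rw [e, lie_smul, ← (serreB_gen s).str_succ, ← lie_skew (str _ _ _), pow_succ, ← gen_val]
      simp only [mul_neg_one, neg_smul, smul_neg, neg_neg, add_assoc]
    · rw [← add_assoc, interval_eq_concat (by omega) (by omega)]
      simp

/-- The span of the root vectors whose root has content `w`. -/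
def rootSpace {r : ℕ} (w : Fin r → ℕ) : Submodule ℂ (Nil r) :=
  Submodule.span ℂ {y | ∃ δ : Root r, δ.content = w ∧ δ.F = y}

lemma F_mem_rootSpace {r : ℕ} (δ : Root r) : δ.F ∈ rootSpace δ.content :=
  Submodule.subset_span ⟨δ, rfl, rfl⟩

lemma F_short {s : ℕ} (i : Fin (s + 1)) :
    (Root.short i).F = str (gen (s + 1)) i (s - i) := by
  rw [Root.F, ← bracket_interval (by omega)]
  congr 2
  omega

lemma F_minus {s : ℕ} (i j : Fin (s + 1)) (h : i < j) :
    (Root.minus i j h).F = str (gen (s + 1)) i (j - i - 1) := by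
  rw [Fin.lt_def] at h
  rw [Root.F, ← bracket_interval (by omega)]
  congr 2
  omega

lemma F_plus {s : ℕ} (i j : Fin (s + 1)) (h : i < j) :
    (Root.plus i j h).F = (-1 : ℂ) ^ (s - j) •
      ⁅str (gen (s + 1)) j (s - j), str (gen (s + 1)) i (s - i)⁆ := by
  rw [← F_short i, Root.F, Root.F, ← smul_lie, ← bracket_interval_reverse (by omega)]
  congr 4
  omega

lemma str_mem_rootSpace {s a n : ℕ} (h : a + n ≤ s) {w : Fin (s + 1) → ℕ}
    (hw : ∀ u, w u = if a ≤ u.val ∧ u.val ≤ a + n then 1 else 0) :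
    str (gen (s + 1)) a n ∈ rootSpace w := by
  rcases h.eq_or_lt with h | h
  · have : (Root.short (⟨a, by omega⟩ : Fin (s + 1))).content = w := by
      funext u
      simp only [Root.content, hw, Fin.le_def]
      split_ifs <;> omega
    rw [← this]
    convert F_mem_rootSpace (Root.short (⟨a, by omega⟩ : Fin (s + 1)))
    rw [F_short]
    congr 1
    dsimp only
    omega
  · have hlt : (⟨a, by omega⟩ : Fin (s + 1)) < ⟨a + n + 1, by omega⟩ := by
      rw [Fin.lt_def]; dsimp only; omega
    have : (Root.minus (⟨a, by omega⟩ : Fin (s + 1)) ⟨a + n + 1, by omega⟩ hlt).content = w := by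
      funext u
      simp only [Root.content, hw, Fin.le_def, Fin.lt_def]
      split_ifs <;> omega
    rw [← this]
    have hF := F_mem_rootSpace (Root.minus (⟨a, by omega⟩ : Fin (s + 1)) ⟨a + n + 1, by omega⟩ hlt)
    rw [F_minus] at hF
    dsimp only at hF
    rwa [show a + n + 1 - a - 1 = n by omega] at hF

lemma lie_str_mem_rootSpace {s a b : ℕ} (hab : a < b) (hb : b ≤ s) {w : Fin (s + 1) → ℕ}
    (hw : ∀ u, w u = if u.val < a then 0 else if u.val < b then 1 else 2) :
    ⁅str (gen (s + 1)) b (s - b), str (gen (s + 1)) a (s - a)⁆ ∈ rootSpace w := by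
  have hlt : (⟨a, by omega⟩ : Fin (s + 1)) < ⟨b, by omega⟩ := by
    rw [Fin.lt_def]; exact hab
  have hc : (Root.plus (⟨a, by omega⟩ : Fin (s + 1)) ⟨b, by omega⟩ hlt).content = w := by
    funext u
    simp only [Root.content, hw, Fin.lt_def]
  have := Submodule.smul_mem _ ((-1 : ℂ) ^ (s - b)) (F_mem_rootSpace
    (Root.plus (⟨a, by omega⟩ : Fin (s + 1)) ⟨b, by omega⟩ hlt))
  rw [F_plus, smul_smul, ← mul_pow, hc] at this
  simpa using this

/-- The bracket of a generator with a root vector is a combination of root vectors of the right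
weight. -/
lemma gen_lie_F_mem {s : ℕ} (i : Fin (s + 1)) (δ : Root (s + 1)) :
    ⁅gen (s + 1) i, δ.F⁆ ∈ rootSpace (δ.content + Pi.single i 1) := by
  have S := serreB_gen s
  have hsingle : ∀ u : Fin (s + 1), (Pi.single i 1 : Fin (s + 1) → ℕ) u =
      if u.val = i.val then 1 else 0 := by
    intro u
    simp only [Pi.single_apply, Fin.ext_iff]
  obtain ⟨i, hi⟩ := i
  dsimp only at hsingle ⊢
  cases δ with
  | short a =>
    obtain ⟨a, ha⟩ := a
    rw [F_short]
    dsimp only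
    rcases (Nat.lt_succ_iff.1 hi).eq_or_lt with rfl | his
    · rcases (Nat.lt_succ_iff.1 ha).eq_or_lt with rfl | has
      · rw [Nat.sub_self, str, lie_self]
        exact zero_mem _
      · have := lie_str_mem_rootSpace (s := i) has le_rfl
          (w := (Root.short ⟨a, ha⟩).content + Pi.single ⟨i, hi⟩ 1) (by
            intro u
            simp only [Root.content, Pi.add_apply, hsingle, Fin.le_def]
            split_ifs <;> omega)
        rwa [Nat.sub_self] at this
    · rw [S.lie_short his (by omega)]
      split_ifs with hia
      · refine str_mem_rootSpace (by omega) fun u => ?_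
        simp only [Root.content, Pi.add_apply, hsingle, Fin.le_def]
        split_ifs <;> omega
      · exact zero_mem _
  | minus a b h =>
    obtain ⟨a, ha⟩ := a
    obtain ⟨b, hb⟩ := b
    rw [F_minus]
    rw [Fin.lt_def] at h
    dsimp only at h ⊢
    obtain ⟨n, rfl⟩ : ∃ n, b = a + n + 1 := ⟨b - a - 1, by omega⟩
    rw [show a + n + 1 - a - 1 = n by omega]
    by_cases h1 : i + 2 ≤ a ∨ a + n + 2 ≤ i
    · rw [S.lie_str_of_far h1]
      exact zero_mem _
    by_cases h2 : i + 1 = a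
    · subst h2
      refine str_mem_rootSpace (a := i) (n := n + 1) (by omega) fun u => ?_
      simp only [Root.content, Pi.add_apply, hsingle, Fin.le_def, Fin.lt_def]
      split_ifs <;> omega
    by_cases h3 : i = a + n + 1
    · subst h3
      rw [← lie_skew, S.str_succ]
      refine neg_mem (str_mem_rootSpace (by omega) fun u => ?_)
      simp only [Root.content, Pi.add_apply, hsingle, Fin.le_def, Fin.lt_def]
      split_ifs <;> omega
    by_cases h4 : i = a
    · subst h4
      cases n with
      | zero => rw [str, lie_self]; exact zero_mem _
      | succ n => rw [S.lie_first]; exact zero_mem _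
    by_cases h5 : i = a + n
    · subst h5
      obtain ⟨n, rfl⟩ : ∃ m, n = m + 1 := ⟨n - 1, by omega⟩
      have e : ⁅gen (s + 1) (a + (n + 1)), str (gen (s + 1)) a (n + 1)⁆ = 0 :=
        S.lie_last (by omega)
      rw [e]
      exact zero_mem _
    · obtain ⟨k, rfl⟩ : ∃ k, i = a + k + 1 := ⟨i - a - 1, by omega⟩
      obtain ⟨m, rfl⟩ : ∃ m, n = k + m + 2 := ⟨n - k - 2, by omega⟩
      rw [S.lie_interior m (by omega)]
      exact zero_mem _
  | plus a b h =>
    obtain ⟨a, ha⟩ := a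
    obtain ⟨b, hb⟩ := b
    rw [F_plus, lie_smul]
    refine Submodule.smul_mem _ _ ?_
    rw [Fin.lt_def] at h
    dsimp only at h ⊢
    rcases (Nat.lt_succ_iff.1 hi).eq_or_lt with rfl | his
    · rw [S.lie_plus h (by omega)]
      exact zero_mem _
    · rw [leibniz_lie, S.lie_short his (by omega), S.lie_short his (by omega)]
      refine add_mem ?_ ?_
      · split_ifs with hib
        · rcases (show i = a ∨ a < i by omega) with rfl | hai
          · rw [lie_self]
            exact zero_mem _
          · refine lie_str_mem_rootSpace hai (by omega) fun u => ?_
            simp only [Root.content, Pi.add_apply, hsingle, Fin.lt_def]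
            split_ifs <;> omega
        · rw [zero_lie]
          exact zero_mem _
      · split_ifs with hia
        · refine lie_str_mem_rootSpace (by omega) (by omega) fun u => ?_
          simp only [Root.content, Pi.add_apply, hsingle, Fin.lt_def]
          split_ifs <;> omega
        · rw [lie_zero]
          exact zero_mem _

lemma f_lie_mem {r : ℕ} (i : Fin r) {w : Fin r → ℕ} {y : Nil r} (hy : y ∈ rootSpace w) :
    ⁅f i, y⁆ ∈ rootSpace (w + Pi.single i 1) := by
  obtain ⟨s, rfl⟩ : ∃ s, r = s + 1 := ⟨r - 1, by have := i.isLt; omega⟩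
  induction hy using Submodule.span_induction with
  | mem y hy =>
    obtain ⟨δ, rfl, rfl⟩ := hy
    rw [← gen_val]
    exact gen_lie_F_mem i δ
  | zero => rw [lie_zero]; exact zero_mem _
  | add y z _ _ h1 h2 => rw [lie_add]; exact add_mem h1 h2
  | smul c y _ h => rw [lie_smul]; exact Submodule.smul_mem _ _ h

/-- Elements whose adjoint action shifts the weight of (the span of) the root vectors by `w`. -/
def IsHom {r : ℕ} (w : Fin r → ℕ) (x : Nil r) : Prop :=
  ∀ w' : Fin r → ℕ, ∀ y ∈ rootSpace w', ⁅x, y⁆ ∈ rootSpace (w' + w)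

lemma IsHom.lie {r : ℕ} {v w : Fin r → ℕ} {x y : Nil r} (hx : IsHom v x) (hy : IsHom w y) :
    IsHom (v + w) ⁅x, y⁆ := by
  intro w' z hz
  rw [lie_lie]
  refine sub_mem ?_ ?_
  · have := hx _ _ (hy _ _ hz)
    rwa [add_assoc, add_comm w v] at this
  · have := hy _ _ (hx _ _ hz)
    rwa [add_assoc] at this

/-- A property of pairs (weight, element of `𝔫`) that is additive under brackets and holds for the
generators holds for iterated brackets. -/
lemma bracket_induction {r : ℕ} {H : (Fin r → ℕ) → Nil r → Prop} (h0 : H 0 0)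
    (hf : ∀ a, H (Pi.single a 1) (f a))
    (hlie : ∀ v w x y, H v x → H w y → H (v + w) ⁅x, y⁆) (l : List (Fin r)) :
    H (fun u => l.count u) (bracket l) := by
  induction l with
  | nil =>
    have : (fun u : Fin r => List.count u []) = 0 := by
      funext u
      simp
    rw [this]
    exact h0
  | cons a l ih =>
    have hc : (fun u => (a :: l).count u) = Pi.single a 1 + fun u => l.count u := by
      funext u
      simp only [List.count_cons, Pi.add_apply, Pi.single_apply, beq_iff_eq, eq_comm (a := a)]
      ring
    rw [hc]
    by_cases hl : l = []
    · subst hl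
      have : (fun u : Fin r => List.count u []) = 0 := by
        funext u
        simp
      rw [this, add_zero]
      exact hf a
    · rw [bracket_cons a hl]
      exact hlie _ _ _ _ (hf a) ih

/-- A property of pairs (weight, element of `𝔫`) that is additive under brackets and holds for the
generators holds for the root vectors. -/
lemma root_induction {r : ℕ} {H : (Fin r → ℕ) → Nil r → Prop} (h0 : H 0 0)
    (hf : ∀ a, H (Pi.single a 1) (f a))
    (hlie : ∀ v w x y, H v x → H w y → H (v + w) ⁅x, y⁆) (δ : Root r) : H δ.content δ.F := by
  have hb := bracket_induction h0 hf hlie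
  cases δ with
  | short i =>
    have hc : (Root.short i).content = fun u => (interval r i r).count u := by
      funext u
      simp only [count_interval, Root.content, Fin.le_def, u.isLt, and_true]
    rw [hc]
    exact hb _
  | minus i j h =>
    have hc : (Root.minus i j h).content = fun u => (interval r i j).count u := by
      funext u
      simp only [count_interval, Root.content, Fin.le_def, Fin.lt_def]
    rw [hc]
    exact hb _
  | plus i j h =>
    have hc : (Root.plus i j h).content = (fun u => (interval r j r).reverse.count u) +
        fun u => (interval r i r).count u := by
      funext u
      rw [Fin.lt_def] at h
      simp only [count_interval, Root.content, Fin.lt_def, u.isLt, and_true, List.count_reverse,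
        Pi.add_apply]
      split_ifs <;> omega
    rw [hc]
    exact hlie _ _ _ _ (hb _) (hb _)

lemma isHom_F {r : ℕ} (δ : Root r) : IsHom δ.content δ.F := by
  refine root_induction (fun w y _ => ?_) (fun a w y hy => f_lie_mem a hy)
    (fun _ _ _ _ hx hy => hx.lie hy) δ
  rw [zero_lie]
  exact zero_mem _

/-- The bracket of two root vectors is a combination of root vectors of the right weight. -/
lemma F_lie_F_mem {r : ℕ} (β γ : Root r) : ⁅β.F, γ.F⁆ ∈ rootSpace (γ.content + β.content) :=
  isHom_F β _ _ (F_mem_rootSpace γ)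

/-! ### The order on the positive roots -/

/-- The index `i` of `ε_i`, `ε_i - ε_j`, `ε_i + ε_j`. -/
def Root.fst {r : ℕ} : Root r → Fin r
  | .short i => i
  | .minus i _ _ => i
  | .plus i _ _ => i

/-- The position of a root among the roots with the same first index. -/
def Root.key {r : ℕ} : Root r → ℕ
  | .short _ => r
  | .minus _ j _ => 2 * r - j
  | .plus _ j _ => j

lemma mem_rootList {r : ℕ} (β : Root r) : β ∈ rootList r := by
  simp only [rootList, List.mem_flatMap, List.mem_append, List.mem_filterMap, List.mem_singleton,
    List.mem_reverse, List.mem_finRange, true_and]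
  cases β with
  | short i => exact ⟨i, by simp⟩
  | minus i j h => exact ⟨i, Or.inr ⟨j, by simp [h]⟩⟩
  | plus i j h => exact ⟨i, Or.inl (Or.inl ⟨j, by simp [h]⟩)⟩

/-- The list of positive roots is ordered by decreasing first index, then by increasing `key`. -/
lemma rootList_pairwise (r : ℕ) : (rootList r).Pairwise fun β γ =>
    γ.fst < β.fst ∨ γ.fst = β.fst ∧ β.key < γ.key := by
  have inc := List.pairwise_lt_finRange r
  rw [rootList, List.pairwise_flatMap]
  constructor
  · intro i _
    refine List.pairwise_append.2 ⟨List.pairwise_append.2 ⟨?_, List.pairwise_singleton _ _, ?_⟩,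
      ?_, ?_⟩
    · rw [List.pairwise_filterMap]
      refine inc.imp fun {j j'} hj b hb b' hb' => ?_
      split_ifs at hb hb'
      cases hb
      cases hb'
      exact Or.inr ⟨rfl, hj⟩
    · intro b hb b' hb'
      simp only [List.mem_filterMap, List.mem_finRange, true_and] at hb
      obtain ⟨j, hj⟩ := hb
      split_ifs at hj
      cases hj
      rw [List.mem_singleton] at hb'
      subst hb'
      exact Or.inr ⟨rfl, j.isLt⟩
    · rw [List.pairwise_filterMap, List.pairwise_reverse]
      refine inc.imp fun {j j'} hj b hb b' hb' => ?_
      split_ifs at hb hb'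
      cases hb
      cases hb'
      refine Or.inr ⟨rfl, ?_⟩
      simp only [Root.key]
      omega
    · intro b hb b' hb'
      simp only [List.mem_filterMap, List.mem_finRange, true_and, List.mem_reverse] at hb'
      obtain ⟨j', hj'⟩ := hb'
      split_ifs at hj'
      cases hj'
      simp only [List.mem_append, List.mem_filterMap, List.mem_finRange, true_and,
        List.mem_singleton] at hb
      rcases hb with ⟨j, hj⟩ | rfl
      · split_ifs at hj
        cases hj
        refine Or.inr ⟨rfl, ?_⟩
        simp only [Root.key]
        omega
      · refine Or.inr ⟨rfl, ?_⟩
        simp only [Root.key]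
        omega
  · rw [List.pairwise_reverse]
    have hfst : ∀ (i : Fin r) (b : Root r),
        b ∈ (List.finRange r).filterMap
          (fun j => if h : i < j then some (Root.plus i j h) else none) ++ [Root.short i] ++
          (List.finRange r).reverse.filterMap
            (fun j => if h : i < j then some (Root.minus i j h) else none) → b.fst = i := by
      intro i b hb
      simp only [List.mem_append, List.mem_filterMap, List.mem_finRange, true_and,
        List.mem_singleton, List.mem_reverse] at hb
      rcases hb with (⟨j, hj⟩ | rfl) | ⟨j, hj⟩
      · split_ifs at hj; cases hj; rfl
      · rfl
      · split_ifs at hj; cases hj; rfl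
    refine inc.imp fun {i i'} hi b hb b' hb' => Or.inl ?_
    rw [hfst _ _ hb, hfst _ _ hb']
    exact hi

lemma rootList_nodup (r : ℕ) : (rootList r).Nodup :=
  (rootList_pairwise r).imp fun h e => by
    subst e
    rcases h with h | h
    · exact absurd h (lt_irrefl _)
    · exact absurd h.2 (lt_irrefl _)

/-! ### Straightening: the PBW monomials span `U(𝔫)` -/

/-- The image of a root vector in `U(𝔫)`. -/
def rv {r : ℕ} (β : Root r) : UNil r := UniversalEnvelopingAlgebra.ι ℂ β.F

/-- The content of a list of positive roots. -/
def listContent {r : ℕ} (l : List (Root r)) : Fin r → ℕ := (l.map Root.content).sum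

lemma listContent_cons {r : ℕ} (β : Root r) (l : List (Root r)) :
    listContent (β :: l) = β.content + listContent l := by
  simp [listContent]

/-- The span of the products of fewer than `n` root vectors of total content `w`. -/
def shortSpan {r : ℕ} (n : ℕ) (w : Fin r → ℕ) : Submodule ℂ (UNil r) :=
  Submodule.span ℂ {y | ∃ l : List (Root r), l.length < n ∧ listContent l = w ∧
    (l.map rv).prod = y}

/-- The span of the PBW monomials of content `w`. -/
def pbwSpan {r : ℕ} (w : Fin r → ℕ) : Submodule ℂ (UNil r) :=
  Submodule.span ℂ {y | ∃ p : Root r →₀ ℕ, pbwContent p = w ∧ pbw p = y}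

lemma rv_mul_mem {r : ℕ} (β : Root r) {n : ℕ} {w : Fin r → ℕ} {y : UNil r}
    (hy : y ∈ shortSpan n w) : rv β * y ∈ shortSpan (n + 1) (β.content + w) := by
  induction hy using Submodule.span_induction with
  | mem y hy =>
    obtain ⟨l, h1, rfl, rfl⟩ := hy
    exact Submodule.subset_span ⟨β :: l, by simpa using h1, listContent_cons _ _, by simp⟩
  | zero => rw [mul_zero]; exact zero_mem _
  | add y z _ _ h1 h2 => rw [mul_add]; exact add_mem h1 h2
  | smul c y _ h => rw [mul_smul_comm]; exact Submodule.smul_mem _ _ h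

lemma ι_mul_prod_mem {r : ℕ} (l : List (Root r)) {w : Fin r → ℕ} {y : Nil r}
    (hy : y ∈ rootSpace w) :
    UniversalEnvelopingAlgebra.ι ℂ y * (l.map rv).prod ∈
      shortSpan (l.length + 2) (w + listContent l) := by
  induction hy using Submodule.span_induction with
  | mem y hy =>
    obtain ⟨δ, rfl, rfl⟩ := hy
    exact Submodule.subset_span ⟨δ :: l, by simp, listContent_cons _ _, by
      rw [List.map_cons, List.prod_cons]; rfl⟩
  | zero => rw [map_zero, zero_mul]; exact zero_mem _
  | add y z _ _ h1 h2 => rw [map_add, add_mul]; exact add_mem h1 h2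
  | smul c y _ h => rw [map_smul, smul_mul_assoc]; exact Submodule.smul_mem _ _ h

/-- Reordering a product of root vectors changes it by shorter products of the same content. -/
lemma prod_sub_prod_mem {r : ℕ} {l₁ l₂ : List (Root r)} (h : l₁.Perm l₂) :
    (l₁.map rv).prod - (l₂.map rv).prod ∈ shortSpan l₁.length (listContent l₁) := by
  induction h with
  | nil => rw [sub_self]; exact zero_mem _
  | cons a _ ih =>
    have := rv_mul_mem a ih
    simpa [mul_sub, listContent_cons] using this
  | swap a b l =>
    have e : ((b :: a :: l).map rv).prod - ((a :: b :: l).map rv).prod =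
        UniversalEnvelopingAlgebra.ι ℂ ⁅b.F, a.F⁆ * (l.map rv).prod := by
      rw [LieHom.map_lie, LieRing.of_associative_ring_bracket]
      simp only [List.map_cons, List.prod_cons, sub_mul, mul_assoc, rv]
    rw [e]
    have := ι_mul_prod_mem l (F_lie_F_mem b a)
    rw [listContent_cons, listContent_cons, ← add_assoc, add_comm b.content]
    exact this
  | trans h1 _ ih1 ih2 =>
    have hc := (h1.map Root.content).sum_eq
    rw [← h1.length_eq, listContent, ← hc] at ih2
    simpa using add_mem ih1 ih2

/-- The nondecreasing list of roots with prescribed multiplicities. -/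
def sortedList {r : ℕ} (p : Root r →₀ ℕ) : List (Root r) :=
  (rootList r).flatMap fun β => List.replicate (p β) β

lemma prod_sortedList {r : ℕ} (p : Root r →₀ ℕ) : ((sortedList p).map rv).prod = pbw p := by
  rw [sortedList, pbw, List.map_flatMap, List.flatMap_def, List.prod_flatten,
    List.map_map]
  congr 1
  refine List.map_congr_left fun β _ => ?_
  rw [Function.comp_apply, List.map_replicate, List.prod_replicate, rv]

open scoped Classical in
lemma count_sortedList {r : ℕ} (p : Root r →₀ ℕ) (β : Root r) : (sortedList p).count β = p β := by
  rw [sortedList, List.count_flatMap, List.sum_map_eq_nsmul_single β,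
    List.count_eq_one_of_mem (rootList_nodup r) (mem_rootList β)]
  · simp
  · intro γ hγ _
    simp [List.count_replicate, hγ]

lemma listContent_sortedList {r : ℕ} (p : Root r →₀ ℕ) :
    listContent (sortedList p) = pbwContent p := by
  classical
  funext u
  have h : ∀ l : List (Root r), listContent l u =
      (Multiset.toFinsupp (l : Multiset (Root r))).sum fun β m => m * β.content u := by
    intro l
    induction l with
    | nil => simp [listContent]
    | cons a l ih =>
      rw [← Multiset.cons_coe, ← Multiset.singleton_add, map_add, Finsupp.sum_add_index', ← ih]
      · simp [listContent_cons]
      · simp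
      · intro _ _ _; ring
  rw [h, pbwContent]
  congr 1
  ext β
  rw [Multiset.toFinsupp_apply, Multiset.coe_count, count_sortedList]

lemma prod_mem_pbwSpan {r : ℕ} (l : List (Root r)) : (l.map rv).prod ∈ pbwSpan (listContent l) := by
  classical
  induction hn : l.length using Nat.strong_induction_on generalizing l with
  | _ n ih =>
  set p := Multiset.toFinsupp (l : Multiset (Root r))
  have hp : l.Perm (sortedList p) := by
    rw [List.perm_iff_count]
    intro β
    rw [count_sortedList, Multiset.toFinsupp_apply, Multiset.coe_count]
  have hle : shortSpan l.length (listContent l) ≤ pbwSpan (listContent l) := by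
    rw [shortSpan, Submodule.span_le]
    rintro _ ⟨l', h1, h2, rfl⟩
    rw [← h2]
    exact ih _ (hn ▸ h1) l' rfl
  have h1 := hle (prod_sub_prod_mem hp)
  have h2 : pbw p ∈ pbwSpan (listContent l) :=
    Submodule.subset_span ⟨p, by
      rw [← listContent_sortedList]
      exact ((hp.map Root.content).sum_eq).symm, rfl⟩
  rw [prod_sortedList] at h1
  simpa using add_mem h1 h2

/-- The simple root of a given colour `u`, i.e. `ε_u - ε_{u+1}`, or `ε_u` for the last colour. -/
def simpleRoot {r : ℕ} (u : Fin r) : Root r :=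
  if h : u.val + 1 < r then .minus u ⟨u + 1, h⟩ (by rw [Fin.lt_def]; exact Nat.lt_succ_self _)
  else .short u

lemma simpleRoot_F {r : ℕ} (u : Fin r) : (simpleRoot u).F = f u := by
  obtain ⟨s, rfl⟩ : ∃ s, r = s + 1 := ⟨r - 1, by have := u.isLt; omega⟩
  rw [simpleRoot]
  split_ifs with h
  · rw [F_minus]
    simp [str, gen_val]
  · rw [F_short, show s - u.val = 0 by omega, str, gen_val]

lemma simpleRoot_content {r : ℕ} (u : Fin r) : (simpleRoot u).content = Pi.single u 1 := by
  funext v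
  rw [simpleRoot]
  split_ifs with h
  · simp only [Root.content, Pi.single_apply, Fin.ext_iff, Fin.le_def, Fin.lt_def]
    split_ifs <;> omega
  · simp only [Root.content, Pi.single_apply, Fin.ext_iff, Fin.le_def]
    split_ifs <;> omega

/-- A word in the generators is a product of the root vectors of simple roots. -/
lemma q_monomial_mem {r : ℕ} {k : Fin r → ℕ} (J : MultiIndex k) :
    q r J.monomial ∈ pbwSpan k := by
  have h1 : q r J.monomial = ((List.ofFn fun v => simpleRoot (J.1 v)).reverse.map rv).prod := by
    rw [MultiIndex.monomial, map_list_prod, List.map_reverse, List.map_reverse, List.map_ofFn,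
      List.map_ofFn]
    congr 3
    funext v
    simp only [q, rv, simpleRoot_F, Function.comp_apply, FreeAlgebra.lift_ι_apply]
  have h2 : listContent (List.ofFn fun v => simpleRoot (J.1 v)).reverse = k := by
    rw [listContent, List.map_reverse, List.sum_reverse, List.map_ofFn, List.sum_ofFn]
    funext u
    rw [Finset.sum_apply, ← J.2 u, Finset.card_filter]
    refine Finset.sum_congr rfl fun v _ => ?_
    simp [simpleRoot_content, Pi.single_apply, eq_comm]
  rw [h1]
  have := prod_mem_pbwSpan (List.ofFn fun v => simpleRoot (J.1 v)).reverse
  rwa [h2] at this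

lemma exists_isPBWExpansion {r : ℕ} (k : Fin r → ℕ) : ∃ ω, IsPBWExpansion k ω := by
  classical
  set P : RatFun k ⊗[ℂ] UNil r → Prop := fun x => ∃ ω : (Root r →₀ ℕ) →₀ RatFun k,
    (∀ p ∈ ω.support, pbwContent p = k) ∧ x = ω.sum fun p a => a ⊗ₜ[ℂ] pbw p
  have h0 : P 0 := ⟨0, by simp, by simp⟩
  have hadd : ∀ x y, P x → P y → P (x + y) := by
    rintro _ _ ⟨ω, h1, rfl⟩ ⟨ω', h1', rfl⟩
    refine ⟨ω + ω', fun p hp => ?_, ?_⟩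
    · rcases Finset.mem_union.1 (Finsupp.support_add hp) with hp | hp
      · exact h1 p hp
      · exact h1' p hp
    · rw [Finsupp.sum_add_index']
      · intro; rw [TensorProduct.zero_tmul]
      · intro _ _ _; rw [TensorProduct.add_tmul]
  have hpure : ∀ y ∈ pbwSpan k, ∀ a : RatFun k, P (a ⊗ₜ y) := by
    intro y hy
    induction hy using Submodule.span_induction with
    | mem y hy =>
      obtain ⟨p, hp, rfl⟩ := hy
      intro a
      refine ⟨Finsupp.single p a, fun p' hp' => ?_, ?_⟩
      · rw [Finset.mem_singleton.1 (Finsupp.support_single_subset hp')]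
        exact hp
      · rw [Finsupp.sum_single_index]
        exact TensorProduct.zero_tmul _ _
    | zero => intro a; rw [TensorProduct.tmul_zero]; exact h0
    | add y z _ _ h1 h2 => intro a; rw [TensorProduct.tmul_add]; exact hadd _ _ (h1 a) (h2 a)
    | smul c y _ h => intro a; rw [← TensorProduct.smul_tmul]; exact h _
  have : P (canonicalFormB k) := by
    rw [canonicalFormB, canonicalForm, map_sum]
    refine Finset.sum_induction _ P hadd h0 fun J _ => ?_
    rw [LinearMap.lTensor_tmul]
    exact hpure _ (q_monomial_mem J) _
  obtain ⟨ω, h1, h2⟩ := this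
  exact ⟨ω, h1, h2⟩

/-! ### The vector representation as a path -/

/-- The colour of the edge from the vertex `p` to the vertex `p + 1` of the path
`0 → 1 → ⋯ → 2r`: the colours are `0, …, r - 1, r - 1, …, 0`. Beyond the vertex `2r` the labels are
not colours. -/
def label (r p : ℕ) : ℕ := if r ≤ p ∧ p < 2 * r then 2 * r - 1 - p else p

/-- The operator moving each vertex along the edge of colour `u` that starts there, if any. -/
def step (r u : ℕ) : Module.End ℂ (ℕ →₀ ℂ) :=
  Finsupp.linearCombination ℂ fun p => if label r p = u then Finsupp.single (p + 1) 1 else 0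

lemma step_single (r u p : ℕ) : step r u (Finsupp.single p 1) =
    if label r p = u then Finsupp.single (p + 1) 1 else 0 := by
  simp [step]

lemma step_mul_eq_zero {r u v : ℕ} (h : ∀ p, label r p = v → label r (p + 1) ≠ u) :
    step r u * step r v = 0 := by
  refine Finsupp.lhom_ext' fun p => LinearMap.ext_ring ?_
  rw [LinearMap.comp_apply, Finsupp.lsingle_apply, Module.End.mul_apply, step_single]
  split_ifs with hp
  · rw [step_single, if_neg (h p hp)]
    rfl
  · exact map_zero _

lemma step_mul_mul_eq_zero {r u v w : ℕ}
    (h : ∀ p, label r p = w → label r (p + 1) = v → label r (p + 1 + 1) ≠ u) :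
    step r u * (step r v * step r w) = 0 := by
  refine Finsupp.lhom_ext' fun p => LinearMap.ext_ring ?_
  rw [LinearMap.comp_apply, Finsupp.lsingle_apply, Module.End.mul_apply, Module.End.mul_apply,
    step_single]
  split_ifs with hp
  · rw [step_single]
    split_ifs with hp'
    · rw [step_single, if_neg (h p hp hp')]
      rfl
    · exact map_zero _
  · rw [map_zero]
    exact map_zero _

section Ring

variable {A : Type*} [Ring A] [Algebra ℂ A] {a b : A}

lemma ad_sq_eq_zero (h1 : a * a = 0) (h2 : a * (b * a) = 0) :
    ((LieAlgebra.ad ℂ A a) ^ 2) b = 0 := by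
  have h3 : a * (a * b) = 0 := by rw [← mul_assoc, h1, zero_mul]
  simp [pow_succ, LieRing.of_associative_ring_bracket, mul_sub, sub_mul, mul_assoc, h1, h2, h3]

lemma ad_cube_eq_zero (h1 : a * (a * a) = 0) (h2 : a * (b * a) = 0) :
    ((LieAlgebra.ad ℂ A a) ^ 3) b = 0 := by
  have h3 : a * (a * (a * b)) = 0 := by
    rw [← mul_assoc, ← mul_assoc, mul_assoc a, h1, zero_mul]
  have h4 : a * (b * (a * a)) = 0 := by rw [← mul_assoc b, ← mul_assoc, h2, zero_mul]
  simp [pow_succ, LieRing.of_associative_ring_bracket, mul_sub, sub_mul, mul_add, add_mul,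
    mul_assoc, h1, h2, h3, h4]

end Ring

/-- The path operators satisfy the Serre relations: each word occurring in one of them has to
vanish, because the corresponding colours never follow each other along the path. -/
lemma step_serre {r : ℕ} {i j : Fin r} (h : i ≠ j) :
    ((LieAlgebra.ad ℂ (Module.End ℂ (ℕ →₀ ℂ)) (step r i)) ^ (1 - cartan i j).toNat) (step r j)
      = 0 := by
  have hij : i.val ≠ j.val := fun e => h (Fin.ext e)
  have hi := i.isLt
  have hj := j.isLt
  rw [cartan, if_neg h]
  split_ifs with h1 h2
  · refine ad_cube_eq_zero (step_mul_mul_eq_zero fun p => ?_) (step_mul_mul_eq_zero fun p => ?_)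
    all_goals
      simp only [label]
      split_ifs <;> omega
  · refine ad_sq_eq_zero (step_mul_eq_zero fun p => ?_) (step_mul_mul_eq_zero fun p => ?_)
    all_goals
      simp only [label]
      split_ifs <;> omega
  · have e1 : step r i * step r j = 0 := step_mul_eq_zero fun p => by
      simp only [label]
      split_ifs <;> omega
    have e2 : step r j * step r i = 0 := step_mul_eq_zero fun p => by
      simp only [label]
      split_ifs <;> omega
    rw [sub_zero, Int.toNat_one, pow_one, LieAlgebra.ad_apply,
      LieRing.of_associative_ring_bracket, e1, e2]
    exact sub_self _

/-- The action of the free Lie algebra on the path. -/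
def freeRep (r : ℕ) : FreeLieAlgebra ℂ (Fin r) →ₗ⁅ℂ⁆ Module.End ℂ (ℕ →₀ ℂ) :=
  FreeLieAlgebra.lift ℂ fun i : Fin r => step r i

lemma freeRep_ad_pow {r : ℕ} (i j : Fin r) (n : ℕ) :
    freeRep r (((LieAlgebra.ad ℂ (FreeLieAlgebra ℂ (Fin r)) (FreeLieAlgebra.of ℂ i)) ^ n)
      (FreeLieAlgebra.of ℂ j)) =
    ((LieAlgebra.ad ℂ (Module.End ℂ (ℕ →₀ ℂ)) (step r i)) ^ n) (step r j) := by
  induction n with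
  | zero => simp [freeRep]
  | succ n ih =>
    rw [pow_succ', pow_succ', Module.End.mul_apply, Module.End.mul_apply, ← ih,
      LieAlgebra.ad_apply, LieAlgebra.ad_apply, LieHom.map_lie]
    simp [freeRep]

lemma serreIdeal_le_ker (r : ℕ) : serreIdeal r ≤ (freeRep r).ker := by
  rw [serreIdeal, LieSubmodule.lieSpan_le]
  rintro _ ⟨i, j, h, rfl⟩
  rw [SetLike.mem_coe, LieHom.mem_ker, freeRep_ad_pow, step_serre h]

/-- The action of `𝔫` on the path. -/
def nilRep (r : ℕ) : Nil r →ₗ⁅ℂ⁆ Module.End ℂ (ℕ →₀ ℂ) where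
  toLinearMap := (serreIdeal r).toSubmodule.liftQ (freeRep r).toLinearMap (serreIdeal_le_ker r)
  map_lie' := by
    intro x y
    obtain ⟨x, rfl⟩ := LieSubmodule.Quotient.surjective_mk' _ x
    obtain ⟨y, rfl⟩ := LieSubmodule.Quotient.surjective_mk' _ y
    exact (freeRep r).map_lie x y

lemma nilRep_f {r : ℕ} (i : Fin r) : nilRep r (f i) = step r i := by
  have : nilRep r (f i) = freeRep r (FreeLieAlgebra.of ℂ i) := rfl
  rw [this, freeRep, FreeLieAlgebra.lift_of_apply]

/-- The action of `U(𝔫)` on the path. -/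
def pathRep (r : ℕ) : UNil r →ₐ[ℂ] Module.End ℂ (ℕ →₀ ℂ) :=
  UniversalEnvelopingAlgebra.lift ℂ (nilRep r)

lemma pathRep_ι {r : ℕ} (x : Nil r) :
    pathRep r (UniversalEnvelopingAlgebra.ι ℂ x) = nilRep r x := by
  rw [pathRep, UniversalEnvelopingAlgebra.lift_ι_apply]

lemma nilRep_lie {r : ℕ} (x y : Nil r) :
    nilRep r ⁅x, y⁆ = nilRep r x * nilRep r y - nilRep r y * nilRep r x := by
  rw [LieHom.map_lie, LieRing.of_associative_ring_bracket]

/-- A word acts by following the path, if its letters are the colours met on the way. -/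
lemma pathRep_word {r n : ℕ} (J : Fin n → Fin r) (s : ℕ) :
    pathRep r (q r ((List.ofFn fun v => FreeAlgebra.ι ℂ (J v)).reverse.prod))
      (Finsupp.single s 1) =
    if ∀ v : Fin n, label r (s + v) = J v then Finsupp.single (s + n) 1 else 0 := by
  induction n with
  | zero => simp
  | succ n ih =>
    rw [List.ofFn_succ', List.concat_eq_append, List.reverse_append, List.reverse_singleton,
      List.singleton_append, List.prod_cons, map_mul, map_mul, Module.End.mul_apply,
      ih (fun v => J v.castSucc)]
    have : pathRep r (q r (FreeAlgebra.ι ℂ (J (Fin.last n)))) = step r (J (Fin.last n)) := by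
      rw [q, FreeAlgebra.lift_ι_apply, pathRep_ι, nilRep_f]
    rw [this]
    simp only [Fin.forall_fin_succ', Fin.val_castSucc, Fin.val_last]
    by_cases h1 : ∀ v : Fin n, label r (s + v) = J v.castSucc
    · rw [if_pos h1, step_single]
      simp [h1, add_assoc]
    · rw [if_neg h1, map_zero, if_neg (fun h => h1 h.1)]

/-! ### Homogeneity of the action -/

/-- The number of edges of colour `u` among the `n` edges following the vertex `s`. -/
def pathCount (r s n : ℕ) (u : Fin r) : ℕ :=
  ∑ v ∈ Finset.range n, if label r (s + v) = u then 1 else 0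

lemma pathCount_add (r s m n : ℕ) :
    pathCount r s (m + n) = pathCount r s m + pathCount r (s + m) n := by
  funext u
  simp only [pathCount, Pi.add_apply, Finset.sum_range_add, add_assoc]

lemma pathCount_eq (r s n : ℕ) (u : Fin r) : pathCount r s n u =
    (if s ≤ u.val ∧ u.val < s + n then 1 else 0) +
      if s ≤ 2 * r - 1 - u.val ∧ 2 * r - 1 - u.val < s + n then 1 else 0 := by
  have hu := u.isLt
  induction n with
  | zero =>
    simp only [pathCount, Finset.range_zero, Finset.sum_empty]
    split_ifs <;> omega
  | succ n ih =>
    rw [pathCount, Finset.sum_range_succ, ← pathCount, ih, label]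
    split_ifs <;> omega

lemma sum_pathCount {r s n : ℕ} (h : s + n ≤ 2 * r) : ∑ u, pathCount r s n u = n := by
  simp only [pathCount]
  rw [Finset.sum_comm]
  have : ∀ v ∈ Finset.range n, (∑ u : Fin r, if label r (s + v) = u then 1 else 0) = 1 := by
    intro v hv
    rw [Finset.mem_range] at hv
    have hl : label r (s + v) < r := by
      rw [label]
      split_ifs <;> omega
    rw [Finset.sum_eq_single (⟨label r (s + v), hl⟩ : Fin r)]
    · simp
    · intro u _ hu
      rw [if_neg]
      exact fun e => hu (Fin.ext e.symm)
    · simp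
  rw [Finset.sum_congr rfl this]
  simp

/-- An element of weight `k` moves each vertex `|k|` steps along the path, and kills it unless the
colours of these steps make up `k`. -/
def MovesBy {r : ℕ} (k : Fin r → ℕ) (x : Nil r) : Prop :=
  ∀ s : ℕ, ∃ c : ℂ, nilRep r x (Finsupp.single s 1) = c • Finsupp.single (s + ∑ u, k u) 1 ∧
    (c ≠ 0 → pathCount r s (∑ u, k u) = k ∧ s + ∑ u, k u ≤ 2 * r)

lemma movesBy_F {r : ℕ} (δ : Root r) : MovesBy δ.content δ.F := by
  refine root_induction ?_ ?_ ?_ δ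
  · exact fun s => ⟨0, by simp, by simp⟩
  · intro a s
    rw [nilRep_f, step_single]
    have hs : ∑ u, (Pi.single a 1 : Fin r → ℕ) u = 1 := by simp
    rw [hs]
    split_ifs with h
    · refine ⟨1, by simp, fun _ => ⟨?_, ?_⟩⟩
      · funext u
        simp only [pathCount, Finset.sum_range_one, add_zero, h, Pi.single_apply, Fin.ext_iff,
          eq_comm]
      · have := a.isLt
        rw [label] at h
        split_ifs at h <;> omega
    · exact ⟨0, by simp, by simp⟩
  · intro v w x y hx hy s
    have key : ∀ (v w : Fin r → ℕ) (x y : Nil r), MovesBy v x → MovesBy w y →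
        ∃ c : ℂ, (nilRep r x * nilRep r y) (Finsupp.single s 1) =
          c • Finsupp.single (s + ∑ u, (v + w) u) 1 ∧
        (c ≠ 0 → pathCount r s (∑ u, (v + w) u) = v + w ∧ s + ∑ u, (v + w) u ≤ 2 * r) := by
      intro v w x y hx hy
      obtain ⟨c, h1, h2⟩ := hy s
      obtain ⟨d, h3, h4⟩ := hx (s + ∑ u, w u)
      have hsum : ∑ u, (v + w) u = ∑ u, w u + ∑ u, v u := by
        simp [Finset.sum_add_distrib, add_comm]
      refine ⟨c * d, ?_, fun h => ?_⟩
      · rw [Module.End.mul_apply, h1, map_smul, h3, smul_smul, hsum, add_assoc]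
      · have h2 := h2 (left_ne_zero_of_mul h)
        have h4 := h4 (right_ne_zero_of_mul h)
        rw [hsum, pathCount_add, h2.1, h4.1]
        exact ⟨add_comm _ _, by omega⟩
    obtain ⟨c, h1, h2⟩ := key v w x y hx hy
    obtain ⟨d, h3, h4⟩ := key w v y x hy hx
    rw [add_comm w v] at h3 h4
    refine ⟨c - d, ?_, fun h => ?_⟩
    · rw [nilRep_lie, LinearMap.sub_apply, h1, h3, sub_smul]
    · by_cases hc : c = 0
      · refine h4 fun hd => h ?_
        rw [hc, hd, sub_zero]
      · exact h2 hc

/-! ### The matrix coefficient attached to a root -/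

/-- The starting vertex of the matrix coefficient that detects `F_β`. The end point is the vertex
`2r - i`, where `i` is the first index of `β`. -/
def Root.start {r : ℕ} : Root r → ℕ
  | .short _ => r
  | .minus _ j _ => 2 * r - j
  | .plus _ j _ => j

/-- The matrix coefficient of `F_β` from the vertex `β.start` to the vertex `2r - i`. -/
def Root.sign {r : ℕ} : Root r → ℂ
  | .short _ => 1
  | .minus _ _ _ => 1
  | .plus _ _ _ => -1

lemma Root.fst_lt_start {r : ℕ} (β : Root r) :
    β.fst.val < β.start ∧ β.start + β.fst.val + 1 ≤ 2 * r := by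
  have := β.fst.isLt
  cases β with
  | short i => simp only [Root.fst, Root.start] at *; omega
  | minus i j h => simp only [Root.fst, Root.start] at *; omega
  | plus i j h => simp only [Root.fst, Root.start] at *; omega

/-- The colours on the path from `β.start` to `2r - i` make up the content of `β`. -/
lemma pathCount_start {r : ℕ} (β : Root r) :
    pathCount r β.start (2 * r - β.fst - β.start) = β.content := by
  funext u
  have hu := u.isLt
  cases β with
  | short i =>
    have hi := i.isLt
    simp only [Root.fst, Root.start, Root.content, Fin.le_def]
    rw [pathCount_eq]
    split_ifs <;> omega
  | minus i j h =>
    have hj := j.isLt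
    simp only [Root.fst, Root.start, Root.content, Fin.le_def, Fin.lt_def] at h ⊢
    rw [pathCount_eq]
    split_ifs <;> omega
  | plus i j h =>
    have hj := j.isLt
    simp only [Root.fst, Root.start, Root.content, Fin.lt_def] at h ⊢
    rw [pathCount_eq]
    split_ifs <;> omega

lemma Root.content_fst {r : ℕ} (β : Root r) : β.content β.fst = 1 := by
  cases β with
  | short i => simp [Root.fst, Root.content]
  | minus i j h => simp [Root.fst, Root.content, h]
  | plus i j h => simp [Root.fst, Root.content, h]

lemma Root.content_of_lt {r : ℕ} (β : Root r) {u : Fin r} (hu : u < β.fst) : β.content u = 0 := by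
  cases β with
  | short i => simp only [Root.fst] at hu; simp [Root.content, hu]
  | minus i j h =>
    simp only [Root.fst] at hu
    simp only [Root.content, Fin.le_def, Fin.lt_def] at *
    split_ifs <;> omega
  | plus i j h => simp only [Root.fst] at hu; simp [Root.content, hu]

lemma Root.content_injective {r : ℕ} : Function.Injective (Root.content (r := r)) := by
  intro β γ h
  have hfst : β.fst = γ.fst := by
    rcases lt_trichotomy β.fst γ.fst with hlt | e | hlt
    · have := γ.content_of_lt hlt
      rw [← h, β.content_fst] at this
      omega
    · exact e
    · have := β.content_of_lt hlt
      rw [h, γ.content_fst] at this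
      omega
  have hr := β.fst.isLt
  have hlast := congr_fun h ⟨r - 1, by omega⟩
  cases β with
  | short i =>
    cases γ with
    | short i' => cases hfst; rfl
    | minus i' j h' =>
      have := j.isLt
      simp only [Root.content, Fin.le_def, Fin.lt_def, Root.fst] at *
      split_ifs at hlast <;> omega
    | plus i' j h' =>
      have := j.isLt
      simp only [Root.content, Fin.le_def, Fin.lt_def, Root.fst] at *
      split_ifs at hlast <;> omega
  | minus i j h' =>
    have := j.isLt
    cases γ with
    | short i' =>
      simp only [Root.content, Fin.le_def, Fin.lt_def, Root.fst] at *
      split_ifs at hlast <;> omega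
    | minus i' j' h'' =>
      cases hfst
      have e : j = j' := by
        have h1 := congr_fun h j
        have h2 := congr_fun h j'
        simp only [Root.content, Fin.le_def, Fin.lt_def, Fin.ext_iff] at *
        split_ifs at h1 h2 <;> omega
      subst e
      rfl
    | plus i' j' h'' =>
      have := j'.isLt
      simp only [Root.content, Fin.le_def, Fin.lt_def, Root.fst] at *
      split_ifs at hlast <;> omega
  | plus i j h' =>
    have := j.isLt
    cases γ with
    | short i' =>
      simp only [Root.content, Fin.le_def, Fin.lt_def, Root.fst] at *
      split_ifs at hlast <;> omega
    | minus i' j' h'' =>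
      have := j'.isLt
      simp only [Root.content, Fin.le_def, Fin.lt_def, Root.fst] at *
      split_ifs at hlast <;> omega
    | plus i' j' h'' =>
      cases hfst
      have e : j = j' := by
        have h1 := congr_fun h j
        have h2 := congr_fun h j'
        simp only [Root.content, Fin.lt_def, Fin.ext_iff] at *
        split_ifs at h1 h2 <;> omega
      subst e
      rfl

/-- Among the root vectors with the same first index as `β`, only `F_β` does not kill the starting
vertex of `β`: the path from there has to stop right after its only edge of colour `i`. -/
lemma nilRep_F_start_eq_zero {r : ℕ} {β γ : Root r} (hfst : γ.fst = β.fst) (hne : γ ≠ β) :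
    nilRep r γ.F (Finsupp.single β.start 1) = 0 := by
  obtain ⟨c, h1, h2⟩ := movesBy_F γ β.start
  rw [h1]
  by_cases hc : c = 0
  · rw [hc, zero_smul]
  obtain ⟨h2, h3⟩ := h2 hc
  set m := ∑ u, γ.content u
  have hs := β.fst_lt_start
  refine absurd (Root.content_injective ?_) hne
  rw [← h2, ← pathCount_start β]
  congr 1
  have e1 := congr_fun h2 γ.fst
  rw [γ.content_fst, pathCount_eq, hfst] at e1
  rcases Nat.eq_zero_or_pos β.fst.val with h0 | h0
  · split_ifs at e1 <;> omega
  · have hlt : (⟨β.fst.val - 1, by omega⟩ : Fin r) < γ.fst := by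
      rw [hfst, Fin.lt_def]
      dsimp only
      omega
    have e2 := congr_fun h2 ⟨β.fst.val - 1, by omega⟩
    rw [γ.content_of_lt hlt, pathCount_eq] at e2
    dsimp only at e2
    split_ifs at e1 e2 <;> omega

/-- The string over the colours `a, …, b - 1` moves along the second half of the path. Only the word
in the order of the bracket contributes, as the other words start with a wrong colour. -/
lemma nilRep_bracket_interval {r a b : ℕ} (hab : a < b) (hb : b ≤ r) :
    nilRep r (bracket (interval r a b)) (Finsupp.single (2 * r - b) 1) =
      Finsupp.single (2 * r - a) 1 := by
  obtain ⟨n, rfl⟩ : ∃ n, b = a + n + 1 := ⟨b - a - 1, by omega⟩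
  have hlab : ∀ c, c < r → label r (2 * r - (c + 1)) = c := by
    intro c hc
    rw [label]
    split_ifs <;> omega
  induction n generalizing a with
  | zero =>
    rw [interval_eq_cons (by omega) (by omega), interval_eq_nil (by omega), bracket, nilRep_f,
      step_single, if_pos (hlab a (by omega))]
    congr 1
    omega
  | succ n ih =>
    have ih := ih (a := a + 1) (by omega) (by omega)
    rw [show a + 1 + n + 1 = a + (n + 1) + 1 by ring] at ih
    rw [interval_eq_cons (by omega) (by omega), bracket_cons, nilRep_lie, LinearMap.sub_apply,
      Module.End.mul_apply, Module.End.mul_apply, ih, nilRep_f, step_single, step_single,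
      if_pos (hlab a (by omega)), hlab (a + (n + 1)) (by omega), if_neg (by dsimp only; omega),
      map_zero, sub_zero]
    · congr 1
      omega
    · rw [interval_eq_cons (by omega) (by omega)]
      simp

/-- The reversed string moves along the first half of the path. -/
lemma nilRep_bracket_interval_reverse {r a b : ℕ} (hab : a < b) (hb : b ≤ r) :
    nilRep r (bracket (interval r a b).reverse) (Finsupp.single a 1) = Finsupp.single b 1 := by
  obtain ⟨n, rfl⟩ : ∃ n, b = a + n + 1 := ⟨b - a - 1, by omega⟩
  have hlab : ∀ c, c < r → label r c = c := by
    intro c hc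
    rw [label]
    split_ifs <;> omega
  induction n with
  | zero =>
    rw [interval_eq_cons (by omega) (by omega), interval_eq_nil (by omega), List.reverse_singleton,
      bracket, nilRep_f, step_single, if_pos (hlab a (by omega)), add_zero]
  | succ n ih =>
    have ih : nilRep r (bracket (interval r a (a + (n + 1))).reverse) (Finsupp.single a 1) =
        Finsupp.single (a + (n + 1)) 1 := ih (by omega) (by omega)
    rw [interval_eq_concat (by omega) (by omega), List.reverse_append, List.reverse_singleton,
      List.singleton_append, bracket_cons, nilRep_lie, LinearMap.sub_apply,
      Module.End.mul_apply, Module.End.mul_apply, nilRep_f, step_single r _ a,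
      if_neg (by rw [hlab a (by omega)]; dsimp only; omega), map_zero, sub_zero, ih, step_single,
      if_pos (hlab _ (by omega))]
    rw [← add_assoc, interval_eq_concat (by omega) (by omega)]
    simp

lemma nilRep_F_start {r : ℕ} (β : Root r) :
    nilRep r β.F (Finsupp.single β.start 1) = β.sign • Finsupp.single (2 * r - β.fst) 1 := by
  cases β with
  | short i =>
    have := nilRep_bracket_interval (a := i) (b := r) i.isLt le_rfl
    rw [show 2 * r - r = r by omega] at this
    simpa [Root.F, Root.start, Root.sign, Root.fst] using this
  | minus i j h =>
    have := nilRep_bracket_interval (a := i) (b := j) h j.isLt.le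
    simpa [Root.F, Root.start, Root.sign, Root.fst] using this
  | plus i j h =>
    -- `F_{ε_i}` kills the starting vertex, so only the subtracted term of the bracket counts
    have h1 : nilRep r (bracket (interval r i r)) (Finsupp.single j.val 1) = 0 :=
      nilRep_F_start_eq_zero (β := .plus i j h) (γ := .short i) rfl (by simp)
    have h2 := nilRep_bracket_interval_reverse (a := j) (b := r) j.isLt le_rfl
    have h3 := nilRep_bracket_interval (a := i) (b := r) i.isLt le_rfl
    rw [show 2 * r - r = r by omega] at h3
    simp only [Root.F, Root.start, Root.sign, Root.fst]
    rw [nilRep_lie, LinearMap.sub_apply, Module.End.mul_apply, Module.End.mul_apply, h1, h2, h3,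
      map_zero, zero_sub, neg_smul, one_smul]

/-! ### The matrix coefficient isolates the coefficient of `F_β` -/

/-- The linear form on `U(𝔫)` reading off the matrix coefficient attached to `β`. -/
def coeff {r : ℕ} (β : Root r) : UNil r →ₗ[ℂ] ℂ :=
  Finsupp.lapply (2 * r - β.fst) ∘ₗ LinearMap.applyₗ (Finsupp.single β.start 1) ∘ₗ
    (pathRep r).toLinearMap

lemma coeff_apply {r : ℕ} (β : Root r) (y : UNil r) :
    coeff β y = pathRep r y (Finsupp.single β.start 1) (2 * r - β.fst) := rfl

lemma pbwContent_add {r : ℕ} (p p' : Root r →₀ ℕ) :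
    pbwContent (p + p') = pbwContent p + pbwContent p' := by
  classical
  funext u
  exact Finsupp.sum_add_index' (by simp) (fun _ _ _ => add_mul _ _ _)

lemma pbwContent_single {r : ℕ} (β : Root r) : pbwContent (Finsupp.single β 1) = β.content := by
  funext u
  simp [pbwContent]

lemma le_pbwContent {r : ℕ} {p : Root r →₀ ℕ} {δ : Root r} (h : p δ ≠ 0) :
    0 < pbwContent p δ.fst := by
  have : p δ * δ.content δ.fst ≤ pbwContent p δ.fst :=
    Finset.single_le_sum (f := fun γ => p γ * γ.content δ.fst) (fun _ _ => Nat.zero_le _)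
      (Finsupp.mem_support_iff.2 h)
  rw [δ.content_fst] at this
  omega

lemma eq_single_of_pbwContent {r : ℕ} {p : Root r →₀ ℕ} {β : Root r} (hβ : p β ≠ 0)
    (hp : pbwContent p = β.content) : p = Finsupp.single β 1 := by
  have hle : Finsupp.single β 1 ≤ p := by
    rw [Finsupp.single_le_iff]
    omega
  have e := add_tsub_cancel_of_le hle
  have h0 : pbwContent (p - Finsupp.single β 1) = 0 := by
    rw [← e, pbwContent_add, pbwContent_single] at hp
    simpa using hp
  have : p - Finsupp.single β 1 = 0 := by
    ext δ
    by_contra h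
    have := le_pbwContent h
    rw [h0] at this
    exact lt_irrefl _ this
  rw [← e, this, add_zero]

/-- A nontrivial ordered product of powers of root vectors ends with a root vector of least first
index. -/
lemma exists_last_factor {r : ℕ} (p : Root r →₀ ℕ) (l : List (Root r))
    (hl : l.Pairwise fun β γ => γ.fst ≤ β.fst) (hex : ∃ δ ∈ l, p δ ≠ 0) :
    ∃ γ, p γ ≠ 0 ∧ (∃ Y : UNil r, (l.map fun β => UniversalEnvelopingAlgebra.ι ℂ β.F ^ p β).prod =
      Y * UniversalEnvelopingAlgebra.ι ℂ γ.F) ∧ γ ∈ l ∧ ∀ δ ∈ l, p δ ≠ 0 → γ.fst ≤ δ.fst := by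
  induction l with
  | nil => simp at hex
  | cons a l ih =>
    rw [List.pairwise_cons] at hl
    by_cases h : ∃ δ ∈ l, p δ ≠ 0
    · obtain ⟨γ, h1, ⟨Y, hY⟩, h2, h3⟩ := ih hl.2 h
      refine ⟨γ, h1, ⟨UniversalEnvelopingAlgebra.ι ℂ a.F ^ p a * Y, ?_⟩,
        List.mem_cons_of_mem _ h2, ?_⟩
      · rw [List.map_cons, List.prod_cons, hY, mul_assoc]
      · intro δ hδ hp
        rcases List.mem_cons.1 hδ with rfl | hδ
        · exact hl.1 _ h2
        · exact h3 δ hδ hp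
    · push Not at h
      have ha : p a ≠ 0 := by
        obtain ⟨δ, hδ, hp⟩ := hex
        rcases List.mem_cons.1 hδ with rfl | hδ
        · exact hp
        · exact absurd (h δ hδ) hp
      have h1 : (l.map fun β => UniversalEnvelopingAlgebra.ι ℂ β.F ^ p β).prod = 1 := by
        refine List.prod_eq_one fun x hx => ?_
        obtain ⟨δ, hδ, rfl⟩ := List.mem_map.1 hx
        rw [h δ hδ, pow_zero]
      refine ⟨a, ha, ⟨UniversalEnvelopingAlgebra.ι ℂ a.F ^ (p a - 1), ?_⟩, List.mem_cons_self, ?_⟩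
      · rw [List.map_cons, List.prod_cons, h1, mul_one, pow_sub_one_mul ha]
      · intro δ hδ hp
        rcases List.mem_cons.1 hδ with rfl | hδ
        · exact le_rfl
        · exact absurd (h δ hδ) hp

lemma pbw_single {r : ℕ} (β : Root r) :
    pbw (Finsupp.single β 1) = UniversalEnvelopingAlgebra.ι ℂ β.F := by
  classical
  rw [pbw, List.prod_map_eq_pow_single β,
    List.count_eq_one_of_mem (rootList_nodup r) (mem_rootList β)]
  · simp only [Finsupp.single_eq_same, pow_one]
  · intro γ hγ _
    rw [Finsupp.single_eq_of_ne (by exact hγ), pow_zero]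

lemma coeff_pbw_single {r : ℕ} (β : Root r) : coeff β (pbw (Finsupp.single β 1)) = β.sign := by
  rw [coeff_apply, pbw_single, pathRep_ι, nilRep_F_start]
  simp

/-- Among the PBW monomials of the content of `β`, the matrix coefficient of `β` only sees `F_β`.
As the content of `β` starts with a `1` in the place of the first index of `β`, the last factor of
such a monomial has this first index, and it kills the starting vertex. -/
lemma coeff_pbw_eq_zero {r : ℕ} {β : Root r} {p : Root r →₀ ℕ} (hp : pbwContent p = β.content)
    (hne : p ≠ Finsupp.single β 1) : coeff β (pbw p) = 0 := by
  obtain ⟨δ, hδ, hδ'⟩ : ∃ δ, p δ ≠ 0 ∧ δ.content β.fst ≠ 0 := by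
    have h := congr_fun hp β.fst
    rw [β.content_fst] at h
    by_contra hcon
    push Not at hcon
    have : pbwContent p β.fst = 0 := by
      refine Finset.sum_eq_zero fun δ hδ => ?_
      dsimp only
      rw [hcon δ (Finsupp.mem_support_iff.1 hδ), mul_zero]
    omega
  have hord : (rootList r).Pairwise fun β γ => γ.fst ≤ β.fst :=
    (rootList_pairwise r).imp fun h => by
      rcases h with h | h
      · exact h.le
      · exact h.1.le
  obtain ⟨γ, hγ, ⟨Y, hY⟩, -, hmin⟩ := exists_last_factor p _ hord ⟨δ, mem_rootList δ, hδ⟩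
  have hfst : γ.fst = β.fst := by
    refine le_antisymm ?_ ?_
    · refine (hmin δ (mem_rootList δ) hδ).trans ?_
      by_contra h
      exact hδ' (δ.content_of_lt (not_le.1 h))
    · by_contra h
      have := le_pbwContent hγ
      rw [hp, β.content_of_lt (not_le.1 h)] at this
      exact lt_irrefl _ this
  have hγβ : γ ≠ β := by
    rintro rfl
    exact hne (eq_single_of_pbwContent hγ hp)
  rw [coeff_apply, pbw, hY, map_mul, Module.End.mul_apply, pathRep_ι,
    nilRep_F_start_eq_zero hfst hγβ, map_zero]
  rfl

lemma sum_content {r : ℕ} (β : Root r) : ∑ u, β.content u = 2 * r - β.fst - β.start := by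
  have := β.fst_lt_start
  rw [← pathCount_start, sum_pathCount]
  omega

/-- The multi-index listing the colours on the path from the starting vertex of `β` to its end
point. -/
def Root.pathIndex {r : ℕ} (β : Root r) : MultiIndex β.content :=
  ⟨fun v => ⟨label r (β.start + v), by
    have h1 := v.isLt
    have h2 := β.fst_lt_start
    have h3 := sum_content β
    rw [label]
    split_ifs <;> omega⟩, fun u => by
    rw [Finset.card_filter]
    simp only [Fin.ext_iff]
    rw [Fin.sum_univ_eq_sum_range (fun v => if label r (β.start + v) = u.val then 1 else 0),
      sum_content, ← pathCount_start]
    rfl⟩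

lemma coeff_monomial {r : ℕ} (β : Root r) (J : MultiIndex β.content) :
    coeff β (q r J.monomial) = if J = β.pathIndex then 1 else 0 := by
  have h2 := β.fst_lt_start
  rw [coeff_apply, MultiIndex.monomial, pathRep_word]
  have hend : β.start + ∑ u, β.content u = 2 * r - β.fst := by
    rw [sum_content]
    omega
  have hiff : (∀ v : Fin (∑ u, β.content u), label r (β.start + v) = J.1 v) ↔ J = β.pathIndex := by
    rw [Subtype.ext_iff, funext_iff]
    simp only [Fin.ext_iff, Root.pathIndex, eq_comm]
  by_cases hJ : J = β.pathIndex
  · rw [if_pos hJ, if_pos (hiff.2 hJ), hend, Finsupp.single_eq_same]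
  · rw [if_neg hJ, if_neg (fun h => hJ (hiff.1 h))]
    rfl

/-- The matrix coefficient of `β`, applied to the second tensor factor. -/
def formCoeff {r : ℕ} (β : Root r) (k : Fin r → ℕ) : RatFun k ⊗[ℂ] UNil r →ₗ[ℂ] RatFun k :=
  (TensorProduct.rid ℂ (RatFun k)).toLinearMap ∘ₗ LinearMap.lTensor (RatFun k) (coeff β)

lemma formCoeff_tmul {r : ℕ} (β : Root r) (k : Fin r → ℕ) (a : RatFun k) (y : UNil r) :
    formCoeff β k (a ⊗ₜ y) = coeff β y • a := by
  simp [formCoeff]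

lemma formCoeff_canonicalFormB {r : ℕ} (β : Root r) :
    formCoeff β β.content (canonicalFormB β.content) = sym β.content β.pathIndex.chain := by
  classical
  rw [canonicalFormB, canonicalForm, map_sum, map_sum, Finset.sum_eq_single β.pathIndex]
  · rw [LinearMap.lTensor_tmul, formCoeff_tmul]
    have := coeff_monomial β β.pathIndex
    rw [if_pos rfl] at this
    rw [AlgHom.toLinearMap_apply, this, one_smul]
  · intro J _ hJ
    rw [LinearMap.lTensor_tmul, formCoeff_tmul, AlgHom.toLinearMap_apply, coeff_monomial,
      if_neg hJ, zero_smul]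
  · intro h
    exact absurd (Finset.mem_univ _) h

/-- The atom of `β` is, up to sign, the symmetrized chain along the path of `β`. -/
theorem isAtom_pathIndex {r : ℕ} (β : Root r) :
    IsAtom β (β.sign • sym β.content β.pathIndex.chain) := by
  refine ⟨exists_isPBWExpansion _, fun ω ⟨h1, h2⟩ => ?_⟩
  have h3 := formCoeff_canonicalFormB β
  have h4 : formCoeff β β.content (ω.sum fun p a => a ⊗ₜ[ℂ] pbw p) =
      β.sign • ω (Finsupp.single β 1) := by
    rw [Finsupp.sum, map_sum, Finset.sum_eq_single (Finsupp.single β 1)]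
    · rw [formCoeff_tmul, coeff_pbw_single]
    · intro p hp hne
      rw [formCoeff_tmul, coeff_pbw_eq_zero (h1 p hp) hne, zero_smul]
    · intro h
      rw [Finsupp.notMem_support_iff.1 h, TensorProduct.zero_tmul, map_zero]
  -- the matrix coefficient of `F_β` is `±1`, so it is its own inverse
  have hs : β.sign * β.sign = 1 := by cases β <;> simp [Root.sign]
  rw [← h3, h2, h4, smul_smul, hs, one_smul]

/-! ### Permuting the variables -/

section Permute

variable {r : ℕ} {k : Fin r → ℕ}

lemma permute_tv (π : ∀ u : Fin r, Equiv.Perm (Fin (k u))) (u : Fin r) (s : Fin (k u)) :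
    permute π (tv k u s) = tv k u (π u s) := by
  rw [permute, tv, IsFractionRing.ringEquivOfRingEquiv_algebraMap]
  simp [tv]

lemma permute_one (x : RatFun k) : permute (fun u => (1 : Equiv.Perm (Fin (k u)))) x = x := by
  have : (MvPolynomial.renameEquiv ℂ (Equiv.sigmaCongrRight
      fun u => (1 : Equiv.Perm (Fin (k u))))).toRingEquiv = RingEquiv.refl _ := by
    have h1 : Equiv.sigmaCongrRight (fun u => (1 : Equiv.Perm (Fin (k u)))) = Equiv.refl _ := rfl
    rw [h1, MvPolynomial.renameEquiv_refl]
    rfl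
  rw [permute, this, IsFractionRing.ringEquivOfRingEquiv_refl]
  rfl

lemma permute_permute (π σ : ∀ u : Fin r, Equiv.Perm (Fin (k u))) (x : RatFun k) :
    permute π (permute σ x) = permute (π * σ) x := by
  have : (MvPolynomial.renameEquiv ℂ (Equiv.sigmaCongrRight (π * σ))).toRingEquiv =
      (MvPolynomial.renameEquiv ℂ (Equiv.sigmaCongrRight σ)).toRingEquiv.trans
        (MvPolynomial.renameEquiv ℂ (Equiv.sigmaCongrRight π)).toRingEquiv := by
    ext p
    simp [MvPolynomial.rename_rename]
    rfl
  rw [permute, permute, permute, this,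
    IsFractionRing.ringEquivOfRingEquiv_comp (RatFun k) (RatFun k) (RatFun k)]
  rfl

lemma sym_permute (σ : ∀ u : Fin r, Equiv.Perm (Fin (k u))) (x : RatFun k) :
    sym k (permute σ x) = sym k x := by
  simp only [sym, permute_permute]
  exact Equiv.sum_comp (Equiv.mulRight σ) fun π => permute π x

lemma sym_add (x y : RatFun k) : sym k (x + y) = sym k x + sym k y := by
  simp only [sym, map_add, Finset.sum_add_distrib]

lemma sym_neg (x : RatFun k) : sym k (-x) = -sym k x := by
  simp only [sym, map_neg, Finset.sum_neg_distrib]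

/-- If each variable occurs only once, there is nothing to symmetrize. -/
lemma sym_of_le_one (hk : ∀ u, k u ≤ 1) (x : RatFun k) : sym k x = x := by
  have hs : ∀ u, Subsingleton (Fin (k u)) := fun u => Fin.subsingleton_iff_le_one.2 (hk u)
  rw [sym, Fintype.sum_eq_single (fun u => 1)]
  · exact permute_one x
  · intro π hπ
    exact absurd (funext fun u => Subsingleton.elim _ _) hπ

lemma tn_eq_tv {u s : ℕ} (hu : u < r) (hs : s < k ⟨u, hu⟩) :
    tn k u s = tv k ⟨u, hu⟩ ⟨s, hs⟩ := by
  rw [tn, dif_pos ⟨hu, hs⟩]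

lemma tv_injective {u v : Fin r} {s : Fin (k u)} {s' : Fin (k v)} (h : tv k u s = tv k v s') :
    u = v ∧ s.val = s'.val := by
  have h := MvPolynomial.X_injective (IsFractionRing.injective _ (RatFun k) h)
  cases h
  exact ⟨rfl, rfl⟩

lemma tv_ne_zero (u : Fin r) (s : Fin (k u)) : tv k u s ≠ 0 := by
  rw [tv, Ne, IsFractionRing.to_map_eq_zero_iff]
  exact MvPolynomial.X_ne_zero _

/-- The transposition of the first two variables of the last colour. -/
def swapLast (k : Fin r → ℕ) (u : Fin r) : Equiv.Perm (Fin (k u)) :=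
  if h : u.val + 1 = r ∧ 1 < k u then Equiv.swap ⟨0, h.2.trans' zero_lt_one⟩ ⟨1, h.2⟩ else 1

lemma permute_swapLast_tn {u s : ℕ} (hu : u + 1 ≠ r) :
    permute (swapLast k) (tn k u s) = tn k u s := by
  by_cases h : ∃ hu : u < r, s < k ⟨u, hu⟩
  · obtain ⟨h1, h2⟩ := h
    rw [tn_eq_tv h1 h2, permute_tv, swapLast, dif_neg (fun h => hu h.1)]
    rfl
  · rw [tn, dif_neg h, map_zero]

lemma permute_swapLast_zero {u : ℕ} (hu : u + 1 = r) (hk : 1 < k ⟨u, by omega⟩) :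
    permute (swapLast k) (tn k u 0) = tn k u 1 := by
  rw [tn_eq_tv (by omega) hk, tn_eq_tv (by omega) (hk.trans' zero_lt_one), permute_tv, swapLast,
    dif_pos ⟨hu, hk⟩, Equiv.swap_apply_left]

lemma permute_swapLast_one {u : ℕ} (hu : u + 1 = r) (hk : 1 < k ⟨u, by omega⟩) :
    permute (swapLast k) (tn k u 1) = tn k u 0 := by
  rw [tn_eq_tv (by omega) hk, tn_eq_tv (by omega) (hk.trans' zero_lt_one), permute_tv, swapLast,
    dif_pos ⟨hu, hk⟩, Equiv.swap_apply_right]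

end Permute

/-! ### The chain along the path of a root -/

/-- The variable at the `v`-th place of the path starting at the vertex `s`. Its lower index is the
number of earlier edges of the same colour. -/
def pathVar {r : ℕ} (k : Fin r → ℕ) (s v : ℕ) : RatFun k :=
  tn k (label r (s + v)) (∑ w ∈ Finset.range v, if label r (s + w) = label r (s + v) then 1 else 0)

/-- The variable preceding the `v`-th one, which is `0` for the first place. -/
def pathPrev {r : ℕ} (k : Fin r → ℕ) (s v : ℕ) : RatFun k :=
  if 0 < v then pathVar k s (v - 1) else 0

lemma pathIndex_t {r : ℕ} (β : Root r) (v : Fin (∑ u, β.content u)) :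
    β.pathIndex.t v = pathVar β.content β.start v := by
  have hc : (∑ w ∈ Finset.range v, if label r (β.start + w) = label r (β.start + v) then 1 else 0) =
      (β.pathIndex.c v).val := by
    change _ = (Finset.univ.filter fun w => w < v ∧ β.pathIndex.1 w = β.pathIndex.1 v).card
    rw [Finset.card_filter]
    simp only [Root.pathIndex, Fin.ext_iff, Fin.lt_def]
    rw [Fin.sum_univ_eq_sum_range
      (fun w => if w < v.val ∧ label r (β.start + w) = label r (β.start + v) then 1 else 0),
      ← Finset.card_filter, ← Finset.card_filter]
    congr 1
    ext w
    have := v.isLt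
    simp only [Finset.mem_filter, Finset.mem_range]
    omega
  rw [pathVar, hc, MultiIndex.t]
  exact (tn_eq_tv (k := β.content) (β.pathIndex.1 v).isLt (β.pathIndex.c v).isLt).symm

lemma pathIndex_chain {r : ℕ} (β : Root r) : β.pathIndex.chain =
    ∏ v ∈ Finset.range (2 * r - β.fst - β.start),
      (pathVar β.content β.start v - pathPrev β.content β.start v)⁻¹ := by
  rw [← sum_content, MultiIndex.chain, ← Fin.prod_univ_eq_prod_range]
  refine Finset.prod_congr rfl fun v _ => ?_
  rw [pathIndex_t, MultiIndex.tPrev, pathPrev]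
  simp only [pathIndex_t]

lemma pathVar_eq {r : ℕ} (k : Fin r → ℕ) {s v u : ℕ} (hu : u < r) (hl : label r (s + v) = u) :
    pathVar k s v = tn k u ((if s ≤ u ∧ u < s + v then 1 else 0) +
      if s ≤ 2 * r - 1 - u ∧ 2 * r - 1 - u < s + v then 1 else 0) := by
  rw [← pathCount_eq r s v ⟨u, hu⟩, pathVar, hl]
  rfl

lemma pathVar_desc {r : ℕ} (k : Fin r → ℕ) {b v : ℕ} (hb : b ≤ r) (hv : v < b) :
    pathVar k (2 * r - b) v = tn k (b - 1 - v) 0 := by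
  rw [pathVar_eq k (u := b - 1 - v) (by omega) (by rw [label]; split_ifs <;> omega),
    if_neg (by omega), if_neg (by omega)]

/-- The chain along the path of `ε_a - ε_b` is the string, read from its root. -/
lemma chain_desc {r : ℕ} (k : Fin r → ℕ) {a b : ℕ} (hab : a < b) (hb : b ≤ r) :
    ∏ v ∈ Finset.range (b - a), (pathVar k (2 * r - b) v - pathPrev k (2 * r - b) v)⁻¹ =
      string k a (b - 1) := by
  obtain ⟨n, rfl⟩ : ∃ n, b = a + n + 1 := ⟨b - a - 1, by omega⟩
  rw [show a + n + 1 - a = n + 1 by omega, Finset.prod_range_succ', string, Nat.add_sub_cancel,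
    Finset.prod_Ico_eq_prod_range, Nat.add_sub_cancel_left, one_div, mul_inv, mul_comm]
  congr 1
  · rw [pathPrev, if_neg (by omega), sub_zero, pathVar_desc k hb (by omega)]
    rfl
  · rw [← Finset.prod_inv_distrib, ← Finset.prod_range_reflect]
    refine Finset.prod_congr rfl fun v hv => ?_
    rw [Finset.mem_range] at hv
    rw [pathPrev, if_pos (by omega), pathVar_desc k hb (by omega), pathVar_desc k hb (by omega)]
    congr 3 <;> omega

section Plus

variable {r : ℕ} (k : Fin r → ℕ) {i j : ℕ}

/-- On the first half of the path, each colour is met for the first time. -/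
lemma pathVar_asc {v : ℕ} (hv : j + v < r) : pathVar k j v = tn k (j + v) 0 := by
  rw [pathVar_eq k (u := j + v) hv (by rw [label]; split_ifs <;> omega),
    if_neg (by omega), if_neg (by omega)]

lemma pathVar_turn (hj : j < r) : pathVar k j (r - j) = tn k (r - 1) 1 := by
  rw [pathVar_eq k (u := r - 1) (by omega) (by rw [label]; split_ifs <;> omega),
    if_pos (by omega), if_neg (by omega)]

/-- On the second half, the colours from `j` on are met for the second time. -/
lemma pathVar_back {x : ℕ} (hj : j < r) (hx : x + 2 ≤ r) :
    pathVar k j (r - j + 1 + x) = labelB k j (r - 2 - x) := by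
  rw [pathVar_eq k (u := r - 2 - x) (by omega) (by rw [label]; split_ifs <;> omega), labelB]
  rw [if_neg (c := j ≤ 2 * r - 1 - (r - 2 - x) ∧ _) (by omega)]
  split_ifs <;> first | rfl | omega

/-- The chain along the path of `ε_i + ε_j`: up the first branch, through the two variables of the
last colour, and down the second branch. -/
lemma chain_plus (hij : i < j) (hj : j < r) :
    ∏ v ∈ Finset.range (2 * r - i - j), (pathVar k j v - pathPrev k j v)⁻¹ =
      (∏ u ∈ Finset.Ico j (r - 1), (labelA k j u - labelA k j (u - 1)))⁻¹ *
        ((tn k (r - 1) 0 - labelA k j (r - 2)) * (tn k (r - 1) 1 - tn k (r - 1) 0) *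
          (labelB k j (r - 2) - tn k (r - 1) 1))⁻¹ *
        (∏ u ∈ Finset.Ico i (r - 2), (labelB k j u - labelB k j (u + 1)))⁻¹ := by
  rw [show 2 * r - i - j = r - 1 - j + 3 + (r - 2 - i) by omega, Finset.prod_range_add,
    Finset.prod_range_add]
  congr 1
  · congr 1
    · rw [Finset.prod_Ico_eq_prod_range, ← Finset.prod_inv_distrib]
      refine Finset.prod_congr rfl fun v hv => ?_
      rw [Finset.mem_range] at hv
      rw [pathVar_asc k (by omega), pathPrev, labelA, if_pos (Nat.le_add_right j v)]
      rcases Nat.eq_zero_or_pos v with rfl | h0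
      · rw [if_neg (lt_irrefl 0), labelA, if_neg (by omega)]
      · rw [if_pos h0, pathVar_asc k (by omega), labelA, if_pos (by omega),
          show j + (v - 1) = j + v - 1 by omega]
    · have e0 : pathVar k j (r - 1 - j) = tn k (r - 1) 0 := by
        rw [pathVar_asc k (by omega), show j + (r - 1 - j) = r - 1 by omega]
      have e1 : pathVar k j (r - 1 - j + 1) = tn k (r - 1) 1 := by
        rw [show r - 1 - j + 1 = r - j by omega, pathVar_turn k hj]
      have e2 : pathVar k j (r - 1 - j + 2) = labelB k j (r - 2) := by
        rw [show r - 1 - j + 2 = r - j + 1 + 0 by omega, pathVar_back k hj (by omega)]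
        rfl
      have p0 : pathPrev k j (r - 1 - j) = labelA k j (r - 2) := by
        rw [pathPrev, labelA]
        split_ifs
        · rw [pathVar_asc k (by omega), show j + (r - 1 - j - 1) = r - 2 by omega]
        · omega
        · omega
        · rfl
      have p1 : pathPrev k j (r - 1 - j + 1) = tn k (r - 1) 0 := by
        rw [pathPrev, if_pos (by omega), Nat.add_sub_cancel, e0]
      have p2 : pathPrev k j (r - 1 - j + 2) = tn k (r - 1) 1 := by
        rw [pathPrev, if_pos (by omega), show r - 1 - j + 2 - 1 = r - 1 - j + 1 by omega, e1]
      rw [Finset.prod_range_succ, Finset.prod_range_succ, Finset.prod_range_one, add_zero, e0, e1,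
        e2, p0, p1, p2, mul_inv, mul_inv]
  · rw [Finset.prod_Ico_eq_prod_range, ← Finset.prod_inv_distrib,
      ← Finset.prod_range_reflect (fun x => (labelB k j (i + x) - labelB k j (i + x + 1))⁻¹)]
    refine Finset.prod_congr rfl fun x hx => ?_
    rw [Finset.mem_range] at hx
    rw [pathPrev, if_pos (by omega), show r - 1 - j + 3 + x = r - j + 1 + (x + 1) by omega,
      pathVar_back k hj (by omega), show r - j + 1 + (x + 1) - 1 = r - j + 1 + x by omega,
      pathVar_back k hj (by omega)]
    congr 3 <;> omega

end Plus

/-- The partial fraction identity behind the double edge: symmetrizing the chain `a, x, y, b` in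
`x` and `y`. -/
lemma chain_add_swap {K : Type*} [Field K] {a b x y : K} (hxy : y - x ≠ 0) (hxa : x - a ≠ 0)
    (hya : y - a ≠ 0) (hbx : b - x ≠ 0) (hby : b - y ≠ 0) :
    ((x - a) * (y - x) * (b - y))⁻¹ + ((y - a) * (x - y) * (b - x))⁻¹ =
      -((a - b) / ((x - a) * (y - a) * (b - x) * (b - y))) := by
  have hyx : x - y ≠ 0 := by
    rw [← neg_sub]
    exact neg_ne_zero.2 hxy
  field_simp
  ring

lemma content_plus_last {r : ℕ} {i j : Fin r} (h : i < j) (hr : r - 1 < r) :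
    (Root.plus i j h).content ⟨r - 1, hr⟩ = 2 := by
  have := j.isLt
  simp only [Root.content, Fin.lt_def] at *
  rw [if_neg (by omega), if_neg (by omega)]

/-- Symmetrizing the chain in the two variables of the last colour gives the double edge. -/
lemma chain_add_permute {r : ℕ} {k : Fin r → ℕ} {i j : ℕ} (hij : i < j) (hj : j < r)
    (hlast : k ⟨r - 1, by omega⟩ = 2) :
    (∏ v ∈ Finset.range (2 * r - i - j), (pathVar k j v - pathPrev k j v)⁻¹) +
      permute (swapLast k)
        (∏ v ∈ Finset.range (2 * r - i - j), (pathVar k j v - pathPrev k j v)⁻¹) =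
    -doubleEdge k i j := by
  have hA : ∀ u, u + 1 ≠ r → permute (swapLast k) (labelA k j u) = labelA k j u := by
    intro u hu
    rw [labelA]
    split_ifs
    · exact permute_swapLast_tn hu
    · exact map_zero _
  have hB : ∀ u, u + 1 ≠ r → permute (swapLast k) (labelB k j u) = labelB k j u := by
    intro u hu
    rw [labelB]
    split_ifs
    · exact permute_swapLast_tn hu
    · exact permute_swapLast_tn hu
  have hPA : permute (swapLast k)
      (∏ u ∈ Finset.Ico j (r - 1), (labelA k j u - labelA k j (u - 1))) =
      ∏ u ∈ Finset.Ico j (r - 1), (labelA k j u - labelA k j (u - 1)) := by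
    rw [map_prod]
    refine Finset.prod_congr rfl fun u hu => ?_
    rw [Finset.mem_Ico] at hu
    rw [map_sub, hA u (by omega), hA (u - 1) (by omega)]
  have hPB : permute (swapLast k)
      (∏ u ∈ Finset.Ico i (r - 2), (labelB k j u - labelB k j (u + 1))) =
      ∏ u ∈ Finset.Ico i (r - 2), (labelB k j u - labelB k j (u + 1)) := by
    rw [map_prod]
    refine Finset.prod_congr rfl fun u hu => ?_
    rw [Finset.mem_Ico] at hu
    rw [map_sub, hB u (by omega), hB (u + 1) (by omega)]
  have hx := permute_swapLast_zero (k := k) (u := r - 1) (by omega) (by omega)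
  have hy := permute_swapLast_one (k := k) (u := r - 1) (by omega) (by omega)
  have hx' := tn_eq_tv (k := k) (u := r - 1) (s := 0) (by omega) (by omega)
  have hy' := tn_eq_tv (k := k) (u := r - 1) (s := 1) (by omega) (by omega)
  -- the labels `a` and `b` are zero or variables of the colour preceding the last one
  have ha : ∀ s : Fin (k ⟨r - 1, by omega⟩), tv k ⟨r - 1, by omega⟩ s - labelA k j (r - 2) ≠ 0 := by
    intro s
    rw [sub_ne_zero, labelA, tn]
    split_ifs with h1 h2
    · intro e
      have := (tv_injective e).1
      rw [Fin.ext_iff] at this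
      dsimp only at this
      omega
    · exact tv_ne_zero _ _
    · exact tv_ne_zero _ _
  have hb : ∀ s : Fin (k ⟨r - 1, by omega⟩), labelB k j (r - 2) - tv k ⟨r - 1, by omega⟩ s ≠ 0 := by
    intro s
    rw [sub_ne_zero, labelB, tn, tn]
    have hne : ∀ (h : r - 2 < r) (s' : Fin (k ⟨r - 2, h⟩)),
        tv k ⟨r - 2, h⟩ s' ≠ tv k ⟨r - 1, by omega⟩ s := by
      intro h s' e
      have := (tv_injective e).1
      rw [Fin.ext_iff] at this
      dsimp only at this
      omega
    split_ifs
    · exact hne _ _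
    · exact (tv_ne_zero _ _).symm
    · exact hne _ _
    · exact (tv_ne_zero _ _).symm
  have hxy : tn k (r - 1) 1 - tn k (r - 1) 0 ≠ 0 := by
    rw [sub_ne_zero, hx', hy']
    intro e
    have := (tv_injective e).2
    dsimp only at this
    omega
  have key := chain_add_swap hxy (hx' ▸ ha _) (hy' ▸ ha _) (hx' ▸ hb _) (hy' ▸ hb _)
  rw [chain_plus k hij hj]
  simp only [map_mul, map_inv₀, map_sub, hPA, hPB, hA (r - 2) (by omega), hB (r - 2) (by omega),
    hx, hy]
  rw [← add_mul, ← mul_add, key, doubleEdge]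
  simp only [div_eq_mul_inv, mul_inv]
  ring

lemma chain_add_permute_chain {r : ℕ} {i j : Fin r} (h : i < j) :
    (Root.plus i j h).pathIndex.chain +
      permute (swapLast (Root.plus i j h).content) (Root.plus i j h).pathIndex.chain =
    -doubleEdge (Root.plus i j h).content i j := by
  rw [pathIndex_chain]
  exact chain_add_permute h j.isLt (content_plus_last h _)

/-- In the atom of `ε_i` each colour occurs at most once, so the symmetrizer is trivial. -/
theorem isAtom_short {r : ℕ} (i : Fin r) :
    IsAtom (Root.short i) (string (Root.short i).content i (r - 1)) := by
  have hi := i.isLt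
  have e : (Root.short i).pathIndex.chain = string (Root.short i).content i (r - 1) := by
    rw [← chain_desc (Root.short i).content hi le_rfl, pathIndex_chain]
    simp only [Root.fst, Root.start]
    rw [show 2 * r - i.val - r = r - i.val by omega, show 2 * r - r = r by omega]
  have hk : ∀ u, (Root.short i).content u ≤ 1 := fun u => by
    simp only [Root.content]
    split_ifs <;> omega
  rw [← e, ← sym_of_le_one hk (Root.pathIndex _).chain, ← one_smul ℂ (sym _ _)]
  exact isAtom_pathIndex (Root.short i)

theorem isAtom_minus {r : ℕ} (i j : Fin r) (h : i < j) :
    IsAtom (Root.minus i j h) (string (Root.minus i j h).content i (j - 1)) := by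
  have hj := j.isLt
  have hij : i.val < j.val := h
  have e : (Root.minus i j h).pathIndex.chain =
      string (Root.minus i j h).content i (j - 1) := by
    rw [← chain_desc (Root.minus i j h).content hij hj.le, pathIndex_chain]
    simp only [Root.fst, Root.start]
    rw [show 2 * r - i.val - (2 * r - j.val) = j.val - i.val by omega]
  have hk : ∀ u, (Root.minus i j h).content u ≤ 1 := fun u => by
    simp only [Root.content]
    split_ifs <;> omega
  rw [← e, ← sym_of_le_one hk (Root.pathIndex _).chain, ← one_smul ℂ (sym _ _)]
  exact isAtom_pathIndex (Root.minus i j h)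

/-- The double edge as the atom of `ε_i + ε_j`. The factor `1 / 2` appears because the double edge
is already symmetric in the two variables of the last colour. -/
theorem isAtom_plus {r : ℕ} (i j : Fin r) (h : i < j) :
    IsAtom (Root.plus i j h) (1 / 2 * sym (Root.plus i j h).content
      (doubleEdge (Root.plus i j h).content i j)) := by
  have e := congr_arg (sym _) (chain_add_permute_chain h)
  rw [sym_add, sym_permute, sym_neg, ← two_mul] at e
  have h2 : (2 : RatFun (Root.plus i j h).content) ≠ 0 := two_ne_zero
  have e' : 1 / 2 * sym (Root.plus i j h).content (doubleEdge (Root.plus i j h).content i j) =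
      (Root.plus i j h).sign • sym _ (Root.plus i j h).pathIndex.chain := by
    rw [← neg_eq_iff_eq_neg.2 e, Root.sign, neg_smul, one_smul]
    field_simp
  rw [e']
  exact isAtom_pathIndex (Root.plus i j h)

end TypeB
end

theorem mainTheorem2 (r : ℕ) :
    (∀ i : Fin r,
      TypeB.IsAtom (TypeB.Root.short i)
        (TypeB.string (TypeB.Root.short i).content i (r - 1))) ∧
    (∀ (i j : Fin r) (h : i < j),
      TypeB.IsAtom (TypeB.Root.minus i j h)
        (TypeB.string (TypeB.Root.minus i j h).content i (j - 1))) ∧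
    (∀ (i j : Fin r) (h : i < j),
      TypeB.IsAtom (TypeB.Root.plus i j h)
        (1 / 2 * TypeB.sym (TypeB.Root.plus i j h).content
          (TypeB.doubleEdge (TypeB.Root.plus i j h).content i j))) :=
  ⟨TypeB.isAtom_short, TypeB.isAtom_minus, TypeB.isAtom_plus⟩
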